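/- Fix integers $d\ge 1$, $L\ge 2$ and reals $\epsilon,\delta>0$; write $\log=\log_2$ and $\gamma=L^{1/d}$. Let $X^*$ be uniform on $[0,1]^d$ and let $Y$ be uniform on $[0,1]$, independent of $X^*$. A querying strategy $\phi$ sequentially submits queries of the form "is $X_i^*\ge q$?" with $i\in\{1,\dots,d\}$ and $q\in[0,1]$; each query, and the decision to stop, is a (measurable) function of the previous noiseless responses $\mathbf 1\{X_i^*\ge q\}$ and of the seed $Y$, and when it stops it outputs an estimator $\widehat X$ that is a function of all queries, all responses and $Y$. The strategy is $\epsilon$-accurate if $\mathbb P\{\|\widehat X-X^*\|_\infty\le\epsilon/2\}=1$, and $(\delta,L)$-private if there is no adversary's estimator $\widetilde X$, computed (possibly with independent randomization) from the query sequence and the knowledge of $\phi$ but without the responses and without $Y$, such that $\mathbb P\{\|\widetilde X-X^*\|_\infty\le\delta/2\}>1/L$. Let $N_d(\epsilon,\delta,L)$ be the minimum $n$ such that some $\epsilon$-accurate and $(\delta,L)$-private strategy always submits at most $n$ queries. Suppose $2\epsilon\le\delta\le 1/\lceil\gamma\rceil$. Then such strategies exist and $$N_d(\epsilon,\delta,L)\le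 d\left(\left\lfloor\log\frac{1}{\lceil\gamma\rceil\delta}\right\rfloor+\lceil\gamma\rceil\left(\left\lceil\log\frac{\delta}{\epsilon}\right\rceil+2\right)-1\right).$$ Furthermore, let $N_d^{\mathrm{sep}}(\epsilon,\delta,L)$ be the same minimum taken only over the strategies for which, for every $i$, the sequence of queries on $X_i^*$ (including its length) depends only on the responses to the previous queries on $X_i^*$ and on a random seed $Y_i$, where $Y_1,\dots,Y_d$ are mutually independent (functions of $Y$). This minimum is also over a nonempty set, and $$N_d^{\mathrm{sep}}(\epsilon,\delta,L)\ge d\left(\left\lfloor\log\frac{1}{\gamma\delta}\right\rfloor+\gamma\left(\log\frac{\delta}{\epsilon}-2\right)-1\right).$$ -/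

import Mathlib

open MeasureTheory ProbabilityTheory
open scoped unitInterval ENNReal

namespace PrivateLearning

/-- What a learner does at one step in dimension `d`: either ask "is `X i ≥ q`?" for a coordinate
`i` and a threshold `q ∈ [0,1]`, which is `Sum.inl (i, q)`, or stop, which is `Sum.inr ()`.
It carries the usual (sum and product) Borel σ-algebra. -/
abbrev Move (d : ℕ) : Type := (Fin d × I) ⊕ Unit

/-- The noiseless responses received so far, the most recent one first; each response is recorded
together with the coordinate that was asked about. -/
abbrev History (d : ℕ) : Type := List (Fin d × Bool)

/-- A querying strategy. The next move and the final estimator are measurable functions of the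
responses received so far and of the seed `y ∈ [0,1]`. -/
structure Strategy (d : ℕ) where
  /-- the next move, given the responses so far and the seed -/
  next : History d → I → Move d
  measurable_next : ∀ h, Measurable (next h)
  /-- the estimator that is used when the strategy stops with the given responses -/
  est : History d → I → (Fin d → ℝ)
  measurable_est : ∀ h, Measurable (est h)

/-- The history after one more move when the true value is `x`: the response to the query
"is `x i ≥ q`?" is noiseless, and nothing is recorded if the learner stops. -/
noncomputable def record {d : ℕ} (x : Fin d → I) (h : History d) : Move d → History d
  | Sum.inl (i, q) => (i, decide (q ≤ x i)) :: h
  | Sum.inr _ => h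

/-- The responses to the queries on coordinate `i` in a history, the most recent one first. -/
def coordHist {d : ℕ} (i : Fin d) (h : History d) : List Bool :=
  (h.filter (fun e => e.1 = i)).map Prod.snd

namespace Strategy

variable {d : ℕ}

/-- The history after `k` steps, when the true value is `x` and the seed is `y`. -/
noncomputable def hist (φ : Strategy d) (x : Fin d → I) (y : I) : ℕ → History d
  | 0 => []
  | k + 1 => record x (φ.hist x y k) (φ.next (φ.hist x y k) y)

/-- The query sequence `q(x, y)`. Its `k`-th entry (counting from `0`) is the query submitted at
step `k`, or `Sum.inr ()` if the strategy has stopped by then (the history, hence the move, no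
longer changes once the strategy has stopped). -/
noncomputable def queries (φ : Strategy d) (x : Fin d → I) (y : I) : ℕ → Move d :=
  fun k => φ.next (φ.hist x y k) y

/-- Whatever the true value and the seed are, at most `n` queries are submitted. -/
def SubmitsAtMost (φ : Strategy d) (n : ℕ) : Prop :=
  ∀ x y, φ.queries x y n = Sum.inr ()

/-- `ε`-accuracy. The true value `x` and the seed `y` are independent and uniform on `[0,1]^d` and
on `[0,1]`. With probability one the strategy stops, and its estimator is then within `ε / 2`
of `x` in the sup norm. -/
def Accurate (φ : Strategy d) (ε : ℝ) : Prop :=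
  ∀ᵐ p : (Fin d → I) × I, ∃ k, φ.queries p.1 p.2 k = Sum.inr () ∧
    ‖φ.est (φ.hist p.1 p.2 k) p.2 - (fun i => (p.1 i : ℝ))‖ ≤ ε / 2

/-- `(δ, L)`-privacy. No adversary `A`, who sees the whole query sequence (but neither responses
nor the learner's seed) and may randomize through an independent uniform variable `u`, is within
`δ / 2` of the true value in the sup norm with probability larger than `1 / L`. -/
def IsPrivate (φ : Strategy d) (δ : ℝ) (L : ℕ) : Prop :=
  ¬ ∃ A : (ℕ → Move d) × I → (Fin d → ℝ), Measurable A ∧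
    (L : ℝ≥0∞)⁻¹ < (volume : Measure (((Fin d → I) × I) × I))
      {p | ‖A (φ.queries p.1.1 p.1.2, p.2) - (fun i => (p.1.1 i : ℝ))‖ ≤ δ / 2}

/-- For every coordinate `i`, the sequence of queries on coordinate `i` (including its length)
depends only on the responses to the previous queries on coordinate `i` and on a random seed
`Y i`, with `Y 1, …, Y d` mutually independent. The seeds are functions of the overall seed;
`ψ i` generates the queries on coordinate `i`, with `Sum.inr ()` for "no further query on
coordinate `i`". The order in which queries on different coordinates are interleaved is
not restricted. -/
def Separable (φ : Strategy d) : Prop :=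
  ∃ (Y : Fin d → I → I) (ψ : Fin d → List Bool → I → I ⊕ Unit),
    (∀ i, Measurable (Y i)) ∧ iIndepFun Y (volume : Measure I) ∧
    (∀ i h, Measurable (ψ i h)) ∧
    ∀ x y k,
      (∀ i q, φ.queries x y k = Sum.inl (i, q) →
        ψ i (coordHist i (φ.hist x y k)) (Y i y) = Sum.inl q) ∧
      (φ.queries x y k = Sum.inr () →
        ∀ i, ψ i (coordHist i (φ.hist x y k)) (Y i y) = Sum.inr ())

end Strategy

/-- The numbers `n` such that some strategy of the class `C` is `ε`-accurate and `(δ, L)`-private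
and submits at most `n` queries. -/
def budgets {d : ℕ} (C : Set (Strategy d)) (ε δ : ℝ) (L : ℕ) : Set ℕ :=
  {n | ∃ φ ∈ C, φ.Accurate ε ∧ φ.IsPrivate δ L ∧ φ.SubmitsAtMost n}

/-- The optimal query complexity over the strategies of the class `C`: the minimum of `budgets`. -/
noncomputable def queryComplexity {d : ℕ} (C : Set (Strategy d)) (ε δ : ℝ) (L : ℕ) : ℕ :=
  sInf (budgets C ε δ L)

/-- `γ = L^{1/d}`. -/
noncomputable def gam (L d : ℕ) : ℝ := (L : ℝ) ^ ((1 : ℝ) / (d : ℝ))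

end PrivateLearning

/-!
# Query complexity of private learning against an eavesdropper

**Upper bound.** Each coordinate is treated separately by a deterministic *replicated bisection*
(`repScheme`). With `G = ⌈γ⌉`, bisection finds a block of length in `[G δ, 2 G δ)` that contains the
coordinate; the block is cut into `G` sub-blocks of length at least `δ`, and `G - 1` queries find the
right one; then bisection is carried out in all `G` sub-blocks at once with the same relative
thresholds. The query sequence shows the block and the position relative to the sub-block, but not
which sub-block is the right one. Given the queries, each coordinate is therefore uniform on `G` cells
that are translates of each other by multiples of at least `δ`, and an interval of length `δ`
captures at most a share of `1 / G` (`volume_code_inter_le`). The coordinates are independent, so an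
adversary wins with probability at most `G ^ (-d) ≤ 1 / L` (`repScheme_strategy_isPrivate`).

**Lower bound.** Cut `[0,1]` into `⌈1 / δ⌉` pieces of length at most `δ`, put
`K = ⌊log₂ (1 / (γ δ))⌋`, and call a query on a coordinate *late* if at least `K` queries on this
coordinate precede it. The first `K` levels of a query tree cut the pieces into at most
`⌈1 / δ⌉ + 2 ^ K - 1 < 2 / δ` cells. Inside a cell only the late queries in the same piece separate
points, and by accuracy the leaves have measure at most `ε` (`SplitsAs.volume_leaf_le`). Hence Kraft's
inequality bounds the mean of `2 ^ (-hits)` by `ε` times the number of cells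
(`lintegral_half_pow_hits_le`), and by Jensen's inequality the mean number of late queries in the
piece of the true value is at least some `c > log₂ (δ / ε) - 1` (`le_integral_hits`). For a separable
strategy and a fixed seed these numbers are independent for the different coordinates, so their
product has mean at least `c ^ d` (`le_lintegral_prod`). An adversary who bets on the pieces of the
best choice of one late query per coordinate wins with at least this mean divided by the number of
such choices, which is at most `((n - d K) / d) ^ d` by the inequality of the means
(`IsPrivate.lintegral_prod_le`). Privacy gives `c ^ d L ≤ ((n - d K) / d) ^ d`, that is,
`n ≥ d (K + γ c)`.
-/

namespace PrivateLearning

/-! ### One-dimensional strategies -/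

/-- The responses, most recent first, collected in `m` steps by the one-dimensional deterministic
strategy `ψ` when the true value is `t`. Once `ψ` stops, the list no longer changes. -/
noncomputable def run (ψ : List Bool → I ⊕ Unit) (t : I) : ℕ → List Bool
  | 0 => []
  | m + 1 => Sum.elim (fun q => decide (q ≤ t) :: run ψ t m) (fun _ => run ψ t m) (ψ (run ψ t m))

section Run

variable {ψ : List Bool → I ⊕ Unit} {t t' q : I} {m n : ℕ}

lemma run_succ_of_inl (h : ψ (run ψ t m) = Sum.inl q) :
    run ψ t (m + 1) = decide (q ≤ t) :: run ψ t m := by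
  rw [run, h]; rfl

lemma run_succ_of_inr (h : ψ (run ψ t m) = Sum.inr ()) : run ψ t (m + 1) = run ψ t m := by
  rw [run, h]; rfl

lemma length_run_eq_or_stopped (ψ : List Bool → I ⊕ Unit) (t : I) (m : ℕ) :
    (run ψ t m).length = m ∨ ψ (run ψ t m) = Sum.inr () := by
  induction m with
  | zero => left; rfl
  | succ m ih =>
    rcases h : ψ (run ψ t m) with q | u
    · left
      rw [run_succ_of_inl h, List.length_cons]
      rcases ih with ih | ih
      · rw [ih]
      · rw [ih] at h; cases h
    · right
      rw [run_succ_of_inr h, h]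

lemma length_run_le (ψ : List Bool → I ⊕ Unit) (t : I) (m : ℕ) : (run ψ t m).length ≤ m := by
  induction m with
  | zero => exact le_rfl
  | succ m ih =>
    rcases h : ψ (run ψ t m) with q | u
    · rw [run_succ_of_inl h, List.length_cons]; omega
    · rw [run_succ_of_inr h]; omega

lemma run_eq_of_stopped (h : ψ (run ψ t m) = Sum.inr ()) (hmn : m ≤ n) :
    run ψ t n = run ψ t m := by
  induction n, hmn using Nat.le_induction with
  | base => rfl
  | succ n _ ih => rw [run_succ_of_inr (by rw [ih, h]), ih]

/-- Earlier lists of responses can be read off from later ones. -/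
lemma run_eq_drop (hmn : m ≤ n) :
    run ψ t m = (run ψ t n).drop ((run ψ t n).length - m) := by
  induction n, hmn using Nat.le_induction with
  | base =>
    have := length_run_le ψ t m
    rw [Nat.sub_eq_zero_of_le this, List.drop_zero]
  | succ n hn ih =>
    rcases h : ψ (run ψ t n) with q | u
    · have hl : (run ψ t n).length = n := by
        rcases length_run_eq_or_stopped ψ t n with h' | h'
        · exact h'
        · rw [h'] at h; cases h
      rw [run_succ_of_inl h, List.length_cons, hl, Nat.sub_add_comm hn, List.drop_succ_cons]
      rw [hl] at ih
      exact ih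
    · rw [run_succ_of_inr h]; exact ih

lemma run_eq_of_le (h : run ψ t n = run ψ t' n) (hmn : m ≤ n) : run ψ t m = run ψ t' m := by
  rw [run_eq_drop hmn, run_eq_drop (t := t') hmn, h]

lemma measurable_decide_le (q : I) : Measurable (fun t : I => decide (q ≤ t)) := by
  refine measurable_to_bool ?_
  have : (fun t : I => decide (q ≤ t)) ⁻¹' {true} = Set.Ici q := by ext; simp
  rw [this]
  exact measurableSet_Ici

lemma measurableSet_run_eq (ψ : List Bool → I ⊕ Unit) (m : ℕ) (h : List Bool) :
    MeasurableSet {t | run ψ t m = h} := by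
  induction m generalizing h with
  | zero => exact MeasurableSet.const ([] = h)
  | succ m ih =>
    have : {t | run ψ t (m + 1) = h} = ⋃ h', {t | run ψ t m = h'} ∩
        {t | Sum.elim (fun q => decide (q ≤ t) :: h') (fun _ => h') (ψ h') = h} := by
      ext t
      simp [run]
    rw [this]
    refine MeasurableSet.iUnion fun h' => (ih h').inter ?_
    rcases ψ h' with q | u
    · exact measurable_decide_le q (MeasurableSet.of_discrete (s := {b | b :: h' = h}))
    · exact MeasurableSet.const (h' = h)

end Run

open Classical in
/-- The number of queries, among those submitted at the steps `K, …, n - 1`, that lie in the same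
piece as the true value `t`. The pieces are the fibres of `p`. -/
noncomputable def hits (ψ : List Bool → I ⊕ Unit) (p : I → ℕ) (K n : ℕ) (t : I) : ℕ :=
  ((Finset.Ico K n).filter (fun m => ∃ q, ψ (run ψ t m) = Sum.inl q ∧ p q = p t)).card

section Hits

variable {ψ : List Bool → I ⊕ Unit} {p : I → ℕ} {K K' m n : ℕ} {t q : I}

lemma hits_anti (h : K ≤ K') : hits ψ p K' n t ≤ hits ψ p K n t := by
  classical
  exact Finset.card_le_card (Finset.filter_subset_filter _ (Finset.Ico_subset_Ico_left h))

lemma hits_le (ψ : List Bool → I ⊕ Unit) (p : I → ℕ) (K n : ℕ) (t : I) : hits ψ p K n t ≤ n := by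
  classical
  refine (Finset.card_filter_le _ _).trans ?_
  simp

lemma hits_eq_add_one (hmn : m < n) (h : ψ (run ψ t m) = Sum.inl q) (hq : p q = p t) :
    hits ψ p m n t = hits ψ p (m + 1) n t + 1 := by
  classical
  rw [hits, hits, ← Finset.insert_Ico_add_one_left_eq_Ico hmn, Finset.filter_insert,
    if_pos ⟨q, h, hq⟩, Finset.card_insert_of_notMem (by simp)]

open Classical in
lemma hits_succ (ψ : List Bool → I ⊕ Unit) (p : I → ℕ) (K n : ℕ) (t : I) :
    hits ψ p K (n + 1) t = hits ψ p K n t +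
      if K ≤ n ∧ ∃ q, ψ (run ψ t n) = Sum.inl q ∧ p q = p t then 1 else 0 := by
  rcases le_or_gt K n with hK | hK
  · rw [hits, hits, ← Finset.insert_Ico_right_eq_Ico_add_one hK, Finset.filter_insert]
    by_cases h : ∃ q, ψ (run ψ t n) = Sum.inl q ∧ p q = p t
    · rw [if_pos h, if_pos ⟨hK, h⟩, Finset.card_insert_of_notMem (by simp)]
    · rw [if_neg h, if_neg (fun h' => h h'.2), add_zero]
  · rw [if_neg (fun h' => absurd h'.1 (by omega)), hits, hits, Finset.Ico_eq_empty (by omega),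
      Finset.Ico_eq_empty (by omega), add_zero]

lemma hits_eq_of_stopped {ψ : List Bool → I ⊕ Unit} {p : I → ℕ} {K m n : ℕ} {t : I}
    (h : ψ (run ψ t m) = Sum.inr ()) (hmn : m ≤ n) : hits ψ p K n t = hits ψ p K m t := by
  induction n, hmn using Nat.le_induction with
  | base => rfl
  | succ n hn ih =>
    rw [hits_succ, ih, run_eq_of_stopped h hn, h]
    simp

lemma measurable_hits (hp : Monotone p) : Measurable (hits ψ p K n) := by
  classical
  have : hits ψ p K n = fun t => ∑ m ∈ Finset.Ico K n,
      {t | ∃ q, ψ (run ψ t m) = Sum.inl q ∧ p q = p t}.indicator (fun _ => 1) t := by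
    ext t
    rw [hits, Finset.card_filter]
    rfl
  rw [this]
  refine Finset.measurable_sum _ fun m _ => measurable_const.indicator ?_
  have : {t | ∃ q, ψ (run ψ t m) = Sum.inl q ∧ p q = p t} = ⋃ h, {t | run ψ t m = h} ∩
      {t | ∃ q, ψ h = Sum.inl q ∧ p q = p t} := by
    ext t
    simp
  rw [this]
  refine MeasurableSet.iUnion fun h => (measurableSet_run_eq ψ m h).inter ?_
  rcases ψ h with q | u
  · have : {t | ∃ q', (Sum.inl q : I ⊕ Unit) = Sum.inl q' ∧ p q' = p t} = p ⁻¹' {p q} := by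
      ext t
      simp [eq_comm]
    rw [this]
    exact hp.measurable MeasurableSet.of_discrete
  · simp

end Hits

/-! ### A Kraft inequality for query trees -/

/-- The number of nodes with a query in the piece `j`, among the first `r` levels of the query tree
of `ψ` below the list of responses `h`. -/
noncomputable def cuts (ψ : List Bool → I ⊕ Unit) (p : I → ℕ) (j : ℕ) : ℕ → List Bool → ℕ
  | 0, _ => 0
  | r + 1, h => Sum.elim
      (fun q => (if p q = j then 1 else 0) + cuts ψ p j r (true :: h) + cuts ψ p j r (false :: h))
      (fun _ => cuts ψ p j r h) (ψ h)

lemma sum_cuts_add_one_le (ψ : List Bool → I ⊕ Unit) (p : I → ℕ) (J r : ℕ) (h : List Bool) :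
    ∑ j ∈ Finset.range J, cuts ψ p j r h + 1 ≤ 2 ^ r := by
  induction r generalizing h with
  | zero => simp [cuts]
  | succ r ih =>
    rcases hq : ψ h with q | u
    · have h1 := ih (true :: h)
      have h2 := ih (false :: h)
      have h3 : ∑ j ∈ Finset.range J, (if p q = j then 1 else 0) ≤ 1 := by
        rw [Finset.sum_ite_eq]; split_ifs <;> simp
      simp only [cuts, hq, Sum.elim_inl, Finset.sum_add_distrib, pow_succ]
      omega
    · have h1 := ih h
      simp only [cuts, hq, Sum.elim_inr, pow_succ]
      omega

/-- Kraft's inequality inside one piece, below a node of the query tree: a query outside the piece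
leaves one of the two children without points of the piece, and a counted query halves the
integrand. -/
lemma lintegral_half_pow_hits_le_of_node {ψ : List Bool → I ⊕ Unit} {p : I → ℕ} {n : ℕ}
    {ε : ℝ≥0∞} (hp : Monotone p) (hleaf : ∀ h, volume {t | run ψ t n = h} ≤ ε) (K j : ℕ)
    {m : ℕ} (hmn : m ≤ n) (h : List Bool) :
    ∫⁻ t in {t | run ψ t m = h ∧ p t = j}, (2⁻¹ : ℝ≥0∞) ^ hits ψ p (max K m) n t ≤
      ε * (1 + cuts ψ p j (K - m) h) := by
  have hmeas : ∀ m h, MeasurableSet {t | run ψ t m = h ∧ p t = j} := fun m h =>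
    (measurableSet_run_eq ψ m h).inter (hp.measurable (MeasurableSet.of_discrete (s := {j})))
  have half_le : (2⁻¹ : ℝ≥0∞) ≤ 1 := by simp
  induction hmn using Nat.decreasingInduction generalizing h with
  | self =>
    calc _ ≤ ∫⁻ t in {t | run ψ t n = h ∧ p t = j}, 1 :=
          lintegral_mono fun t => pow_le_one₀ zero_le half_le
      _ ≤ volume {t | run ψ t n = h} := by
          rw [setLIntegral_one]; exact measure_mono fun t ht => ht.1
      _ ≤ ε := hleaf h
      _ ≤ _ := le_mul_of_one_le_right zero_le le_self_add
  | of_succ m hm ih =>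
    set f : ℕ → I → ℝ≥0∞ := fun m t => (2⁻¹ : ℝ≥0∞) ^ hits ψ p (max K m) n t with hf
    set S : ℕ → List Bool → Set I := fun m h => {t | run ψ t m = h ∧ p t = j} with hS
    have hfle : ∀ t, f m t ≤ f (m + 1) t := fun t =>
      pow_le_pow_of_le_one zero_le half_le (hits_anti (max_le_max le_rfl (Nat.le_succ m)))
    have hstep : ∫⁻ t in S m h, f m t ≤ ∫⁻ t in S m h, f (m + 1) t := lintegral_mono hfle
    rcases hq : ψ h with q | u
    · have hsub : S m h ⊆ S (m + 1) (true :: h) ∪ S (m + 1) (false :: h) := by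
        rintro t ⟨ht, htj⟩
        have := run_succ_of_inl (ψ := ψ) (t := t) (m := m) (q := q) (by rw [ht, hq])
        rw [ht] at this
        rcases Decidable.em (q ≤ t) with hqt | hqt
        · left; exact ⟨by rw [this]; simp [hqt], htj⟩
        · right; exact ⟨by rw [this]; simpa using hqt, htj⟩
      have hboth : ∫⁻ t in S m h, f (m + 1) t ≤
          ε * (1 + cuts ψ p j (K - (m + 1)) (true :: h)) +
          ε * (1 + cuts ψ p j (K - (m + 1)) (false :: h)) :=
        (lintegral_mono_set hsub).trans ((lintegral_union_le _ _ _).trans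
          (add_le_add (ih _) (ih _)))
      by_cases hj : p q = j
      · rcases le_or_gt K m with hK | hK
        · have e1 : K - (m + 1) = 0 := by omega
          have e2 : K - m = 0 := by omega
          have : ∫⁻ t in S m h, f m t = 2⁻¹ * ∫⁻ t in S m h, f (m + 1) t := by
            rw [← lintegral_const_mul' _ _ (by simp)]
            refine setLIntegral_congr_fun (hmeas m h) fun t ht => ?_
            simp only [hf]
            rw [max_eq_right hK, max_eq_right (hK.trans (Nat.le_succ m)),
              hits_eq_add_one hm (by rw [ht.1, hq]) (hj.trans ht.2.symm), pow_succ']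
          rw [this, e2]
          rw [e1] at hboth
          simp only [cuts, Nat.cast_zero, add_zero, mul_one] at hboth ⊢
          calc _ ≤ 2⁻¹ * (ε + ε) := by gcongr
            _ = ε := by
              rw [← two_mul, ← mul_assoc, ENNReal.inv_mul_cancel (by simp) (by simp), one_mul]
        · obtain ⟨r, hr⟩ : ∃ r, K - m = r + 1 := ⟨K - m - 1, by omega⟩
          have e1 : K - (m + 1) = r := by omega
          refine hstep.trans (hboth.trans (le_of_eq ?_))
          rw [hr, e1]
          simp only [cuts, hq, Sum.elim_inl, if_pos hj]
          push_cast
          ring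
      · have hone : ∃ b, S m h ⊆ S (m + 1) (b :: h) := by
          rcases lt_or_gt_of_ne hj with hlt | hlt
          · refine ⟨true, fun t ht => (hsub ht).resolve_right fun h' => ?_⟩
            have h1 := run_succ_of_inl (ψ := ψ) (t := t) (m := m) (q := q) (by rw [ht.1, hq])
            rw [h'.1, List.cons.injEq] at h1
            have h2 : t < q := by simpa using h1.1
            have := hp h2.le
            rw [ht.2] at this
            omega
          · refine ⟨false, fun t ht => (hsub ht).resolve_left fun h' => ?_⟩
            have h1 := run_succ_of_inl (ψ := ψ) (t := t) (m := m) (q := q) (by rw [ht.1, hq])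
            rw [h'.1, List.cons.injEq] at h1
            have h2 : q ≤ t := by simpa using h1.1
            have := hp h2
            rw [ht.2] at this
            omega
        obtain ⟨b, hb⟩ := hone
        refine hstep.trans ((lintegral_mono_set hb).trans ((ih _).trans ?_))
        gcongr
        rcases le_or_gt K m with hK | hK
        · rw [Nat.sub_eq_zero_of_le (hK.trans (Nat.le_succ m))]
          simp [cuts]
        · obtain ⟨r, hr⟩ : ∃ r, K - m = r + 1 := ⟨K - m - 1, by omega⟩
          have e1 : K - (m + 1) = r := by omega
          rw [hr, e1]
          simp only [cuts, hq, Sum.elim_inl]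
          cases b <;> omega
    · have hsub : S m h ⊆ S (m + 1) h := by
        rintro t ⟨ht, htj⟩
        exact ⟨by rw [run_succ_of_inr (by rw [ht, hq]), ht], htj⟩
      refine hstep.trans ((lintegral_mono_set hsub).trans ((ih h).trans (le_of_eq ?_)))
      rcases le_or_gt K m with hK | hK
      · rw [Nat.sub_eq_zero_of_le (hK.trans (Nat.le_succ m)), Nat.sub_eq_zero_of_le hK]
      · obtain ⟨r, hr⟩ : ∃ r, K - m = r + 1 := ⟨K - m - 1, by omega⟩
        have e1 : K - (m + 1) = r := by omega
        rw [hr, e1]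
        simp only [cuts, hq, Sum.elim_inr]

/-- Kraft's inequality with `J` pieces when the first `K` levels of the tree are not counted: these
levels cut the pieces into at most `J + 2 ^ K - 1` cells. -/
lemma lintegral_half_pow_hits_le {ψ : List Bool → I ⊕ Unit} {p : I → ℕ} {n : ℕ}
    {ε : ℝ≥0∞} (hp : Monotone p) (hleaf : ∀ h, volume {t | run ψ t n = h} ≤ ε) (K : ℕ)
    {J : ℕ} (hJ : ∀ t, p t < J) :
    ∫⁻ t, (2⁻¹ : ℝ≥0∞) ^ hits ψ p K n t ≤ ε * (J + 2 ^ K - 1 : ℕ) := by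
  calc _ = ∫⁻ t in ⋃ j : Fin J, {t | run ψ t 0 = [] ∧ p t = j},
          (2⁻¹ : ℝ≥0∞) ^ hits ψ p (max K 0) n t := by
        rw [max_eq_left (Nat.zero_le K), Set.iUnion_eq_univ_iff.2, setLIntegral_univ]
        exact fun t => ⟨⟨p t, hJ t⟩, rfl, rfl⟩
    _ ≤ ∑' j : Fin J, ∫⁻ t in {t | run ψ t 0 = [] ∧ p t = j},
          (2⁻¹ : ℝ≥0∞) ^ hits ψ p (max K 0) n t := lintegral_iUnion_le _ _
    _ ≤ ∑' j : Fin J, ε * (1 + cuts ψ p j (K - 0) []) :=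
        ENNReal.tsum_le_tsum fun j =>
          lintegral_half_pow_hits_le_of_node hp hleaf K j (Nat.zero_le n) []
    _ = ε * (J + ∑ j ∈ Finset.range J, cuts ψ p j K [] : ℕ) := by
        rw [tsum_fintype, ← Finset.mul_sum,
          Fin.sum_univ_eq_sum_range (fun j => 1 + (cuts ψ p j (K - 0) [] : ℝ≥0∞)),
          Finset.sum_add_distrib]
        simp
    _ ≤ _ := by
        have := sum_cuts_add_one_le ψ p J K []
        gcongr
        omega

/-- The entropy bound: a location uniform on `[0,1]` is hit at least `-log₂ (ε (J + 2 ^ K - 1))`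
times on average. -/
lemma le_integral_hits {ψ : List Bool → I ⊕ Unit} {p : I → ℕ} {n : ℕ}
    {ε : ℝ} (hε : 0 < ε) (hp : Monotone p)
    (hleaf : ∀ h, volume {t | run ψ t n = h} ≤ ENNReal.ofReal ε) (K : ℕ)
    {J : ℕ} (hJ : ∀ t, p t < J) :
    -Real.logb 2 (ε * (J + 2 ^ K - 1 : ℝ)) ≤ ∫ t, (hits ψ p K n t : ℝ) := by
  have hJ0 : 1 ≤ J := (hJ 0).pos
  have hcast : ((J + 2 ^ K - 1 : ℕ) : ℝ) = J + 2 ^ K - 1 := by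
    rw [Nat.cast_sub (hJ0.trans (Nat.le_add_right _ _))]; push_cast; ring
  have hJr : (1 : ℝ) ≤ J := by exact_mod_cast hJ0
  set B : ℝ := ε * (J + 2 ^ K - 1 : ℝ) with hB
  have hBpos : 0 < B := by
    have : (0 : ℝ) < 2 ^ K := by positivity
    refine mul_pos hε (by linarith)
  have hmeas : Measurable (fun t => (hits ψ p K n t : ℝ)) :=
    measurable_from_nat.comp (measurable_hits (ψ := ψ) (K := K) (n := n) hp)
  have hint : Integrable (fun t => (hits ψ p K n t : ℝ)) volume := by
    refine Integrable.of_bound hmeas.aestronglyMeasurable n (ae_of_all _ fun t => ?_)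
    simpa using hits_le ψ p K n t
  have hmeas2 : Measurable (fun t => (2⁻¹ : ℝ) ^ hits ψ p K n t) :=
    (measurable_from_nat (f := fun k : ℕ => (2⁻¹ : ℝ) ^ k)).comp
      (measurable_hits (ψ := ψ) (K := K) (n := n) hp)
  have hint2 : Integrable (fun t => (2⁻¹ : ℝ) ^ hits ψ p K n t) volume := by
    refine Integrable.of_bound hmeas2.aestronglyMeasurable 1 (ae_of_all _ fun t => ?_)
    rw [norm_pow]
    exact pow_le_one₀ (norm_nonneg _) (by norm_num)
  have hkraft : ∫ t, (2⁻¹ : ℝ) ^ hits ψ p K n t ≤ B := by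
    rw [integral_eq_lintegral_of_nonneg_ae (ae_of_all _ fun t => by positivity)
      hmeas2.aestronglyMeasurable]
    refine ENNReal.toReal_le_of_le_ofReal hBpos.le ?_
    have := lintegral_half_pow_hits_le hp hleaf K hJ
    rw [hB, ENNReal.ofReal_mul hε.le, ← hcast, ENNReal.ofReal_natCast]
    refine le_trans (le_of_eq (lintegral_congr fun t => ?_)) this
    rw [ENNReal.ofReal_pow (by norm_num), ENNReal.ofReal_inv_of_pos (by norm_num)]
    simp
  have hlog2 : 0 < Real.log 2 := Real.log_pos (by norm_num)
  -- The tangent line of the exponential at the point where `2⁻¹ ^ hits` equals `B`.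
  have htan : ∀ t, B * ((1 - Real.log B) - hits ψ p K n t * Real.log 2) ≤
      (2⁻¹ : ℝ) ^ hits ψ p K n t := by
    intro t
    have h1 := Real.add_one_le_exp (-Real.log B - hits ψ p K n t * Real.log 2)
    have h2 : (2⁻¹ : ℝ) ^ hits ψ p K n t =
        B * Real.exp (-Real.log B - hits ψ p K n t * Real.log 2) := by
      rw [Real.exp_sub, Real.exp_neg, Real.exp_log hBpos, Real.exp_nat_mul,
        Real.exp_log two_pos, inv_pow]
      field_simp
    rw [h2]
    gcongr
    linarith
  have hle : ∫ t, B * ((1 - Real.log B) - hits ψ p K n t * Real.log 2) ≤ B :=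
    (integral_mono (((integrable_const _).sub (hint.mul_const _)).const_mul _) hint2
      htan).trans hkraft
  rw [integral_const_mul, integral_sub (integrable_const _) (hint.mul_const _),
    integral_mul_const] at hle
  simp only [integral_const, probReal_univ, smul_eq_mul, one_mul] at hle
  have h3 : (1 - Real.log B) - (∫ t, (hits ψ p K n t : ℝ)) * Real.log 2 ≤ 1 := by
    by_contra hcon
    push Not at hcon
    nlinarith
  rw [Real.logb, ← neg_div, div_le_iff₀ hlog2]
  linarith

/-! ### Histories of multi-dimensional strategies -/

variable {d : ℕ}

/-- The coordinate asked about by a move, and `none` if the move is to stop. -/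
def moveCoord (m : Move d) : Option (Fin d) := Sum.elim (fun p => some p.1) (fun _ => none) m

/-- The threshold of the query submitted by a move; `0` if the move is to stop. -/
def moveThr (m : Move d) : I := Sum.elim Prod.snd (fun _ => 0) m

lemma measurable_moveThr : Measurable (moveThr : Move d → I) :=
  Measurable.sumElim measurable_snd measurable_const

lemma measurableSet_moveCoord_eq (o : Option (Fin d)) :
    MeasurableSet {m : Move d | moveCoord m = o} := by
  rw [measurableSet_sum_iff]
  constructor
  · exact measurable_fst (MeasurableSet.of_discrete (s := {i | some i = o}))
  · exact MeasurableSet.const (none = o)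

lemma moveCoord_eq_some {m : Move d} {i : Fin d} :
    moveCoord m = some i ↔ m = Sum.inl (i, moveThr m) := by
  rcases m with ⟨j, q⟩ | u
  · simp [moveCoord, moveThr]
  · simp [moveCoord]

lemma moveCoord_eq_none {m : Move d} : moveCoord m = none ↔ m = Sum.inr () := by
  rcases m with ⟨j, q⟩ | u
  · simp [moveCoord]
  · simp [moveCoord]

lemma record_of_some {m : Move d} {i : Fin d} (h : moveCoord m = some i) (x : Fin d → I)
    (H : History d) : record x H m = (i, decide (moveThr m ≤ x i)) :: H := by
  rw [moveCoord_eq_some] at h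
  rw [h]; rfl

lemma record_of_none {m : Move d} (h : moveCoord m = none) (x : Fin d → I)
    (H : History d) : record x H m = H := by
  rw [moveCoord_eq_none] at h
  rw [h]; rfl

@[simp] lemma coordHist_nil (i : Fin d) : coordHist i [] = [] := rfl

lemma coordHist_cons_self (i : Fin d) (b : Bool) (H : History d) :
    coordHist i ((i, b) :: H) = b :: coordHist i H := by
  simp [coordHist]

lemma coordHist_cons_of_ne {i j : Fin d} (h : j ≠ i) (b : Bool) (H : History d) :
    coordHist i ((j, b) :: H) = coordHist i H := by
  simp [coordHist, h]

namespace Strategy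

variable {φ : Strategy d} {x x' : Fin d → I} {y : I} {k n : ℕ} {i j : Fin d}

lemma hist_succ (φ : Strategy d) (x : Fin d → I) (y : I) (k : ℕ) :
    φ.hist x y (k + 1) = record x (φ.hist x y k) (φ.queries x y k) := rfl

lemma coordHist_hist_succ_self (h : moveCoord (φ.queries x y k) = some i) :
    coordHist i (φ.hist x y (k + 1)) =
      decide (moveThr (φ.queries x y k) ≤ x i) :: coordHist i (φ.hist x y k) := by
  rw [hist_succ, record_of_some h, coordHist_cons_self]

lemma coordHist_hist_succ_of_ne (h : moveCoord (φ.queries x y k) ≠ some i) :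
    coordHist i (φ.hist x y (k + 1)) = coordHist i (φ.hist x y k) := by
  rcases h' : moveCoord (φ.queries x y k) with _ | j
  · rw [hist_succ, record_of_none h']
  · rw [hist_succ, record_of_some h', coordHist_cons_of_ne]
    rintro rfl
    exact h h'

lemma length_coordHist_hist_le (φ : Strategy d) (x : Fin d → I) (y : I) (i : Fin d) (k : ℕ) :
    (coordHist i (φ.hist x y k)).length ≤ k := by
  induction k with
  | zero => exact le_rfl
  | succ k ih =>
    by_cases h : moveCoord (φ.queries x y k) = some i
    · rw [coordHist_hist_succ_self h, List.length_cons]; omega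
    · rw [coordHist_hist_succ_of_ne h]; omega

lemma hist_eq_of_stopped (h : φ.queries x y k = Sum.inr ()) (hkn : k ≤ n) :
    φ.hist x y n = φ.hist x y k := by
  induction n, hkn using Nat.le_induction with
  | base => rfl
  | succ n _ ih =>
    have : φ.queries x y n = Sum.inr () := by rw [queries, ih]; exact h
    rw [hist_succ, this, ← ih]; rfl

lemma measurableSet_hist_eq (φ : Strategy d) (k : ℕ) (H : History d) :
    MeasurableSet {p : (Fin d → I) × I | φ.hist p.1 p.2 k = H} := by
  induction k generalizing H with
  | zero => exact MeasurableSet.const ([] = H)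
  | succ k ih =>
    have : {p : (Fin d → I) × I | φ.hist p.1 p.2 (k + 1) = H} =
        ⋃ H', {p : (Fin d → I) × I | φ.hist p.1 p.2 k = H'} ∩
          {p | record p.1 H' (φ.next H' p.2) = H} := by
      ext p
      simp [hist]
    rw [this]
    refine MeasurableSet.iUnion fun H' => (ih H').inter ?_
    have hnext : Measurable fun p : (Fin d → I) × I => φ.next H' p.2 :=
      (φ.measurable_next H').comp measurable_snd
    have : {p : (Fin d → I) × I | record p.1 H' (φ.next H' p.2) = H} =
        ⋃ o : Option (Fin d), {p | moveCoord (φ.next H' p.2) = o} ∩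
          {p | (match o with
            | some i => (i, decide (moveThr (φ.next H' p.2) ≤ p.1 i)) :: H'
            | none => H') = H} := by
      ext p
      rcases h : moveCoord (φ.next H' p.2) with _ | i
      · simp [record_of_none h, h]
      · simp [record_of_some h, h]
    rw [this]
    refine MeasurableSet.iUnion fun o => (hnext (measurableSet_moveCoord_eq o)).inter ?_
    rcases o with _ | i
    · exact MeasurableSet.const (H' = H)
    · have hle : MeasurableSet {p : (Fin d → I) × I | moveThr (φ.next H' p.2) ≤ p.1 i} :=
        measurableSet_le (measurable_moveThr.comp hnext)
          ((measurable_pi_apply i).comp measurable_fst)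
      have hb : Measurable
          fun p : (Fin d → I) × I => decide (moveThr (φ.next H' p.2) ≤ p.1 i) := by
        refine measurable_to_bool ?_
        convert hle using 1
        ext; simp
      exact hb (MeasurableSet.of_discrete (s := {b | (i, b) :: H' = H}))

lemma measurable_queries (φ : Strategy d) (k : ℕ) :
    Measurable fun p : (Fin d → I) × I => φ.queries p.1 p.2 k := by
  intro U hU
  have : (fun p : (Fin d → I) × I => φ.queries p.1 p.2 k) ⁻¹' U =
      ⋃ H, {p : (Fin d → I) × I | φ.hist p.1 p.2 k = H} ∩ {p | φ.next H p.2 ∈ U} := by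
    ext p
    simp [queries]
  rw [this]
  exact MeasurableSet.iUnion fun H => (measurableSet_hist_eq φ k H).inter
    (((φ.measurable_next H).comp measurable_snd) hU)

/-- For the fixed seed `y`, the queries that `φ` submits on the coordinate `i` are those of the
one-dimensional strategy `ψ i`. -/
def SplitsAs (φ : Strategy d) (y : I) (ψ : Fin d → List Bool → I ⊕ Unit) : Prop :=
  ∀ x k,
    (∀ i q, φ.queries x y k = Sum.inl (i, q) → ψ i (coordHist i (φ.hist x y k)) = Sum.inl q) ∧
    (φ.queries x y k = Sum.inr () → ∀ i, ψ i (coordHist i (φ.hist x y k)) = Sum.inr ())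

namespace SplitsAs

variable {ψ : Fin d → List Bool → I ⊕ Unit}

lemma apply_coordHist (hs : φ.SplitsAs y ψ) (h : moveCoord (φ.queries x y k) = some i) :
    ψ i (coordHist i (φ.hist x y k)) = Sum.inl (moveThr (φ.queries x y k)) :=
  (hs x k).1 i _ (moveCoord_eq_some.1 h)

lemma coordHist_eq_run (hs : φ.SplitsAs y ψ) (x : Fin d → I) (i : Fin d) (k : ℕ) :
    coordHist i (φ.hist x y k) = run (ψ i) (x i) (coordHist i (φ.hist x y k)).length := by
  induction k with
  | zero => rfl
  | succ k ih =>
    by_cases h : moveCoord (φ.queries x y k) = some i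
    · have h1 := hs.apply_coordHist h
      rw [ih] at h1
      rw [coordHist_hist_succ_self h, List.length_cons, run_succ_of_inl h1, ← ih]
    · rw [coordHist_hist_succ_of_ne h]; exact ih

lemma coordHist_final (hs : φ.SplitsAs y ψ) (hn : φ.SubmitsAtMost n) (x : Fin d → I)
    (i : Fin d) : coordHist i (φ.hist x y n) = run (ψ i) (x i) n := by
  have h := (hs x n).2 (hn x y) i
  rw [hs.coordHist_eq_run x i n] at h
  rw [run_eq_of_stopped h (length_coordHist_hist_le φ x y i n), ← hs.coordHist_eq_run x i n]

/-- Two values of the coordinate `i` that produce the same responses on that coordinate cannot be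
told apart as long as the other coordinates are the same. -/
lemma hist_update_eq (hs : φ.SplitsAs y ψ) {t t' : I} (h : run (ψ i) t n = run (ψ i) t' n)
    (x : Fin d → I) (hk : k ≤ n) :
    φ.hist (Function.update x i t) y k = φ.hist (Function.update x i t') y k := by
  induction k with
  | zero => rfl
  | succ k ih =>
    have ih := ih (by omega)
    have hq : φ.queries (Function.update x i t) y k = φ.queries (Function.update x i t') y k := by
      rw [queries, queries, ih]
    rw [hist_succ, hist_succ, ← ih, ← hq]
    rcases hc : moveCoord (φ.queries (Function.update x i t) y k) with _ | j
    · rw [record_of_none hc, record_of_none hc]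
    · rw [record_of_some hc, record_of_some hc]
      by_cases hji : j = i
      · subst hji
        set ℓ := (coordHist j (φ.hist (Function.update x j t) y k)).length with hℓ
        have e1 := hs.coordHist_eq_run (Function.update x j t) j k
        have e2 := hs.coordHist_eq_run (Function.update x j t') j k
        have a1 := hs.apply_coordHist hc
        rw [hq] at hc
        have a2 := hs.apply_coordHist hc
        rw [Function.update_self, ← hℓ] at e1
        rw [Function.update_self, ← ih, ← hℓ] at e2
        rw [e1] at a1
        rw [← ih, e2, ← hq] at a2
        have hℓk : ℓ ≤ k := length_coordHist_hist_le φ _ y j k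
        have h1 := run_eq_of_le h (show ℓ + 1 ≤ n by omega)
        rw [run_succ_of_inl a1, run_succ_of_inl a2, List.cons.injEq] at h1
        rw [Function.update_self, Function.update_self, h1.1]
      · rw [Function.update_of_ne hji, Function.update_of_ne hji]

end SplitsAs

end Strategy

/-! ### Leaves of an accurate strategy -/

/-- Resampling one coordinate of a uniform point of the cube leaves it uniform. -/
lemma measurePreserving_update (i : Fin d) :
    MeasurePreserving (fun p : (Fin d → I) × I => Function.update p.1 i p.2) volume volume := by
  have hm : Measurable (fun p : (Fin d → I) × I => Function.update p.1 i p.2) := by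
    refine measurable_pi_iff.2 fun j => ?_
    by_cases h : j = i
    · subst h; simpa using measurable_snd
    · simp only [Function.update_of_ne h]
      exact (measurable_pi_apply j).comp measurable_fst
  refine ⟨hm, (Measure.pi_eq fun s hs => ?_).symm⟩
  rw [Measure.map_apply hm (MeasurableSet.univ_pi hs)]
  have : (fun p : (Fin d → I) × I => Function.update p.1 i p.2) ⁻¹' Set.univ.pi s =
      (Set.univ.pi (Function.update s i Set.univ)) ×ˢ s i := by
    ext p
    simp only [Set.mem_preimage, Set.mem_univ_pi, Set.mem_prod]
    constructor
    · intro h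
      refine ⟨fun j => ?_, by simpa using h i⟩
      by_cases hj : j = i
      · subst hj; simp
      · simpa [Function.update_of_ne hj] using h j
    · rintro ⟨h1, h2⟩ j
      by_cases hj : j = i
      · subst hj; simpa using h2
      · simpa [Function.update_of_ne hj] using h1 j
  rw [this, Measure.volume_eq_prod, Measure.prod_prod, volume_pi_pi,
    ← Finset.mul_prod_erase Finset.univ _ (Finset.mem_univ i),
    ← Finset.mul_prod_erase Finset.univ (fun j => volume (s j)) (Finset.mem_univ i)]
  rw [Function.update_self, measure_univ, one_mul, mul_comm]
  congr 1
  refine Finset.prod_congr rfl fun j hj => ?_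
  rw [Function.update_of_ne (Finset.ne_of_mem_erase hj)]

lemma volume_coe_mem_le (s : Set ℝ) : volume {t : I | (t : ℝ) ∈ s} ≤ volume s := by
  rw [unitInterval.volume_apply]
  exact measure_mono (Set.image_subset_iff.2 fun t ht => ht)

lemma volume_abs_sub_le (c r : ℝ) :
    volume {t : I | |c - t| ≤ r} ≤ ENNReal.ofReal (2 * r) := by
  calc _ ≤ volume {t : I | (t : ℝ) ∈ Set.Icc (c - r) (c + r)} := by
        refine measure_mono fun t ht => ?_
        have := abs_le.1 (show |c - t| ≤ r from ht)
        constructor <;> linarith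
    _ ≤ volume (Set.Icc (c - r) (c + r)) := volume_coe_mem_le _
    _ = _ := by rw [Real.volume_Icc]; congr 1; ring

namespace Strategy

variable {φ : Strategy d} {y : I} {n : ℕ} {ψ : Fin d → List Bool → I ⊕ Unit} {ε : ℝ}

lemma Accurate.ae_final (hacc : φ.Accurate ε) (hn : φ.SubmitsAtMost n) :
    ∀ᵐ y : I, ∀ᵐ x : Fin d → I, ‖φ.est (φ.hist x y n) y - (fun i => (x i : ℝ))‖ ≤ ε / 2 := by
  have h1 : ∀ᵐ p : (Fin d → I) × I,
      ‖φ.est (φ.hist p.1 p.2 n) p.2 - (fun i => (p.1 i : ℝ))‖ ≤ ε / 2 := by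
    filter_upwards [hacc] with p ⟨k, hk, hle⟩
    have : φ.hist p.1 p.2 n = φ.hist p.1 p.2 k := by
      rcases le_total k n with h | h
      · exact hist_eq_of_stopped hk h
      · exact (hist_eq_of_stopped (hn p.1 p.2) h).symm
    rwa [this]
  have h2 := (Measure.measurePreserving_swap (μ := (volume : Measure I))
    (ν := (volume : Measure (Fin d → I)))).quasiMeasurePreserving.ae h1
  exact Measure.ae_ae_of_ae_prod h2

/-- The values of one coordinate that produce the same responses form a set of measure at most
`ε`: with the other coordinates fixed, they lead to the same estimate. -/
lemma SplitsAs.volume_leaf_le (hs : φ.SplitsAs y ψ)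
    (hgood : ∀ᵐ x : Fin d → I, ‖φ.est (φ.hist x y n) y - (fun i => (x i : ℝ))‖ ≤ ε / 2)
    (i : Fin d) (h : List Bool) : volume {t | run (ψ i) t n = h} ≤ ENNReal.ofReal ε := by
  have h1 := Measure.ae_ae_of_ae_prod
    ((measurePreserving_update i).quasiMeasurePreserving.ae hgood)
  obtain ⟨x, hx⟩ := h1.exists
  rcases Set.eq_empty_or_nonempty {t | run (ψ i) t n = h} with he | ⟨t₀, ht₀⟩
  · rw [he]; simp
  set c : ℝ := φ.est (φ.hist (Function.update x i t₀) y n) y i with hc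
  calc volume {t | run (ψ i) t n = h} ≤ volume {t : I | |c - t| ≤ ε / 2} := by
        refine measure_mono_ae ?_
        filter_upwards [hx] with t ht htl
        have h2 : φ.hist (Function.update x i t) y n = φ.hist (Function.update x i t₀) y n :=
          hs.hist_update_eq (Eq.trans htl (Eq.symm ht₀)) x le_rfl
        have h3 := (norm_le_pi_norm _ i).trans ht
        rw [Pi.sub_apply, h2, Function.update_self, Real.norm_eq_abs] at h3
        exact h3
    _ ≤ ENNReal.ofReal (2 * (ε / 2)) := volume_abs_sub_le _ _
    _ = ENNReal.ofReal ε := by congr 1; ring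

end Strategy

/-! ### The adversary that bets on late queries -/

/-- The times before `n` at which a query on the coordinate `i` is submitted that is preceded by at
least `K` queries on the same coordinate. -/
def lateTimes (K n : ℕ) (Q : ℕ → Move d) (i : Fin d) : Finset ℕ :=
  (Finset.range n).filter (fun k => moveCoord (Q k) = some i ∧
    K ≤ ((Finset.range k).filter (fun k' => moveCoord (Q k') = some i)).card)

lemma card_lateTimes (K n : ℕ) (Q : ℕ → Move d) (i : Fin d) : (lateTimes K n Q i).card =
    ((Finset.range n).filter (fun k => moveCoord (Q k) = some i)).card - K := by
  induction n with
  | zero => simp [lateTimes]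
  | succ n ih =>
    rw [lateTimes] at ih ⊢
    by_cases h : moveCoord (Q n) = some i
    · by_cases hK : K ≤ ((Finset.range n).filter (fun k' => moveCoord (Q k') = some i)).card
      · rw [Finset.range_add_one, Finset.filter_insert, if_pos ⟨h, hK⟩, Finset.filter_insert,
          if_pos h, Finset.card_insert_of_notMem (by simp), Finset.card_insert_of_notMem (by simp),
          ih]
        omega
      · rw [Finset.range_add_one, Finset.filter_insert, if_neg (fun h' => hK h'.2),
          Finset.filter_insert, if_pos h, Finset.card_insert_of_notMem (by simp), ih]
        omega
    · rw [Finset.range_add_one, Finset.filter_insert, if_neg (fun h' => h h'.1),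
        Finset.filter_insert, if_neg h, ih]

lemma sum_card_lateTimes_add_le {K n : ℕ} {Q : ℕ → Move d}
    (h : ∀ i, (lateTimes K n Q i).Nonempty) :
    ∑ i, (lateTimes K n Q i).card + d * K ≤ n := by
  have h1 : ∀ i, (lateTimes K n Q i).card + K =
      ∑ k ∈ Finset.range n, if moveCoord (Q k) = some i then 1 else 0 := fun i => by
    have h2 := (h i).card_pos
    rw [card_lateTimes] at h2 ⊢
    rw [← Finset.card_filter]
    omega
  calc _ = ∑ i, ((lateTimes K n Q i).card + K) := by simp [Finset.sum_add_distrib]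
    _ = ∑ k ∈ Finset.range n, ∑ i, if moveCoord (Q k) = some i then 1 else 0 := by
        simp_rw [h1]; exact Finset.sum_comm
    _ ≤ ∑ k ∈ Finset.range n, 1 := by
        refine Finset.sum_le_sum fun k _ => ?_
        rcases moveCoord (Q k) with _ | j <;> simp
    _ = n := by simp

lemma prod_le_mean_pow (hd : d ≠ 0) (z : Fin d → ℝ) (hz : ∀ i, 0 ≤ z i) :
    ∏ i, z i ≤ ((∑ i, z i) / d) ^ d := by
  have hd' : (d : ℝ) ≠ 0 := by exact_mod_cast hd
  have h := Real.geom_mean_le_arith_mean_weighted Finset.univ (fun _ => (d : ℝ)⁻¹) z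
    (fun _ _ => by positivity) (by simp [hd']) (fun i _ => hz i)
  have h2 := pow_le_pow_left₀ (Finset.prod_nonneg fun i _ => Real.rpow_nonneg (hz i) _) h d
  rw [← Finset.prod_pow, ← Finset.mul_sum, inv_mul_eq_div] at h2
  refine le_trans (le_of_eq (Finset.prod_congr rfl fun i _ => ?_)) h2
  rw [← Real.rpow_natCast, ← Real.rpow_mul (hz i), inv_mul_cancel₀ hd', Real.rpow_one]

lemma card_piFinset_lateTimes_le (hd : d ≠ 0) (K n : ℕ) (Q : ℕ → Move d) :
    ((Fintype.piFinset (lateTimes K n Q)).card : ℝ≥0∞) ≤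
      ENNReal.ofReal ((n - d * K : ℝ) / d) ^ d := by
  by_cases h : ∀ i, (lateTimes K n Q i).Nonempty
  · have h1 : (∑ i, ((lateTimes K n Q i).card : ℝ)) + d * K ≤ n := by
      exact_mod_cast sum_card_lateTimes_add_le h
    have h0 : (0 : ℝ) ≤ ∑ i, ((lateTimes K n Q i).card : ℝ) :=
      Finset.sum_nonneg fun i _ => Nat.cast_nonneg _
    rw [← ENNReal.ofReal_pow (div_nonneg (by linarith) (Nat.cast_nonneg _)),
      ← ENNReal.ofReal_natCast, Fintype.card_piFinset, Nat.cast_prod]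
    refine ENNReal.ofReal_le_ofReal
      ((prod_le_mean_pow hd _ fun i => Nat.cast_nonneg _).trans ?_)
    gcongr
    linarith
  · push Not at h
    obtain ⟨i, hi⟩ := h
    rw [Fintype.card_piFinset, Finset.prod_eq_zero (Finset.mem_univ i) (by rw [hi]; rfl)]
    simp

lemma measurableSet_mem_lateTimes (K n k : ℕ) (i : Fin d) :
    MeasurableSet {Q : ℕ → Move d | k ∈ lateTimes K n Q i} := by
  have h1 : ∀ k, MeasurableSet {Q : ℕ → Move d | moveCoord (Q k) = some i} := fun k =>
    (measurable_pi_apply (X := fun _ : ℕ => Move d) k) (measurableSet_moveCoord_eq (some i))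
  have h2 : Measurable fun Q : ℕ → Move d =>
      ((Finset.range k).filter (fun k' => moveCoord (Q k') = some i)).card := by
    have : (fun Q : ℕ → Move d =>
        ((Finset.range k).filter (fun k' => moveCoord (Q k') = some i)).card) =
        fun Q => ∑ k' ∈ Finset.range k,
          {Q : ℕ → Move d | moveCoord (Q k') = some i}.indicator (fun _ => 1) Q := by
      ext Q
      rw [Finset.card_filter]
      refine Finset.sum_congr rfl fun k' _ => ?_
      rw [Set.indicator_apply]
      rfl
    rw [this]
    exact Finset.measurable_sum _ fun k' _ => measurable_const.indicator (h1 k')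
  have : {Q : ℕ → Move d | k ∈ lateTimes K n Q i} = {Q | k < n} ∩
      ({Q | moveCoord (Q k) = some i} ∩ {Q | K ≤
        ((Finset.range k).filter (fun k' => moveCoord (Q k') = some i)).card}) := by
    ext Q
    simp [lateTimes]
  rw [this]
  exact (MeasurableSet.const _).inter ((h1 k).inter (measurableSet_le measurable_const h2))

lemma measurableSet_lateTimes_eq (K n : ℕ) (r : Fin d → Finset ℕ) :
    MeasurableSet {Q : ℕ → Move d | lateTimes K n Q = r} := by
  have : {Q : ℕ → Move d | lateTimes K n Q = r} =
      ⋂ i, ⋂ k, {Q | k ∈ lateTimes K n Q i ↔ k ∈ r i} := by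
    ext Q
    simp [funext_iff, Finset.ext_iff]
  rw [this]
  refine MeasurableSet.iInter fun i => MeasurableSet.iInter fun k => ?_
  by_cases hk : k ∈ r i
  · simpa [hk] using measurableSet_mem_lateTimes K n k i
  · simp only [hk, iff_false]
    exact (measurableSet_mem_lateTimes K n k i).compl

namespace Strategy

variable {φ : Strategy d} {x : Fin d → I} {y : I} {n : ℕ} {i : Fin d}

lemma measurable_queries_pi (φ : Strategy d) :
    Measurable fun p : (Fin d → I) × I => φ.queries p.1 p.2 :=
  measurable_pi_iff.2 fun k => measurable_queries φ k

lemma length_coordHist_hist (φ : Strategy d) (x : Fin d → I) (y : I) (i : Fin d) (k : ℕ) :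
    (coordHist i (φ.hist x y k)).length =
      ((Finset.range k).filter (fun k' => moveCoord (φ.queries x y k') = some i)).card := by
  induction k with
  | zero => rfl
  | succ k ih =>
    rw [Finset.range_add_one, Finset.filter_insert]
    by_cases h : moveCoord (φ.queries x y k) = some i
    · rw [if_pos h, coordHist_hist_succ_self h, List.length_cons, ih,
        Finset.card_insert_of_notMem (by simp)]
    · rw [if_neg h, coordHist_hist_succ_of_ne h, ih]

/-- The late queries of `φ` on the coordinate `i` in the piece of `x i` are those counted by `hits`
for the one-dimensional strategy that generates the queries on this coordinate. -/
lemma SplitsAs.card_lateTimes_eq_hits {ψ : Fin d → List Bool → I ⊕ Unit} (hs : φ.SplitsAs y ψ)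
    (hn : φ.SubmitsAtMost n) (p : I → ℕ) (K : ℕ) (x : Fin d → I) (i : Fin d) :
    ((lateTimes K n (φ.queries x y) i).filter
      (fun k => p (moveThr (φ.queries x y k)) = p (x i))).card = hits (ψ i) p K n (x i) := by
  classical
  have hlate : ∀ m, (lateTimes K m (φ.queries x y) i).filter
      (fun k => p (moveThr (φ.queries x y k)) = p (x i)) =
      (Finset.range m).filter (fun k => moveCoord (φ.queries x y k) = some i ∧
        K ≤ (coordHist i (φ.hist x y k)).length ∧
        p (moveThr (φ.queries x y k)) = p (x i)) := by
    intro m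
    ext k
    simp [lateTimes, length_coordHist_hist, and_assoc]
  have key : ∀ k, ((lateTimes K k (φ.queries x y) i).filter
      (fun k => p (moveThr (φ.queries x y k)) = p (x i))).card =
        hits (ψ i) p K (coordHist i (φ.hist x y k)).length (x i) := by
    intro k
    induction k with
    | zero => simp [lateTimes, hist, hits]
    | succ k ih =>
      rw [hlate] at ih ⊢
      rw [Finset.range_add_one, Finset.filter_insert]
      by_cases h : moveCoord (φ.queries x y k) = some i
      · have h1 := hs.apply_coordHist h
        rw [hs.coordHist_eq_run x i k] at h1
        rw [coordHist_hist_succ_self h, List.length_cons, hits_succ, ← ih, h1]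
        by_cases h2 : K ≤ (coordHist i (φ.hist x y k)).length ∧
            p (moveThr (φ.queries x y k)) = p (x i)
        · rw [if_pos ⟨h, h2⟩, if_pos ⟨h2.1, _, rfl, h2.2⟩,
            Finset.card_insert_of_notMem (by simp)]
        · rw [if_neg (fun h' => h2 h'.2), if_neg]
          · rfl
          · rintro ⟨hK, q, hq, hp⟩
            cases hq
            exact h2 ⟨hK, hp⟩
      · rw [if_neg (fun h' => h h'.1), coordHist_hist_succ_of_ne h, ih]
  have hfin := (hs x n).2 (hn x y) i
  rw [hs.coordHist_eq_run x i n] at hfin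
  rw [key n, hits_eq_of_stopped hfin (length_coordHist_hist_le φ x y i n)]

end Strategy

namespace Strategy

variable {φ : Strategy d} {δ ε : ℝ} {L : ℕ} {p : I → ℕ}

/-- The adversary that looks at the times of the late queries, picks one of these times for every
coordinate by the rule `κ`, and bets that the true value lies in the piece of the query submitted
then. -/
lemma IsPrivate.volume_bet_le (hpriv : φ.IsPrivate δ L) (hp : Measurable p) {center : ℕ → ℝ}
    (hc : ∀ t : I, |center (p t) - t| ≤ δ / 2) (K n : ℕ)
    (κ : (Fin d → Finset ℕ) → Fin d → ℕ) :
    volume {z : (Fin d → I) × I | ∀ i,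
      p (moveThr (φ.queries z.1 z.2 (κ (lateTimes K n (φ.queries z.1 z.2)) i))) = p (z.1 i)} ≤
      (L : ℝ≥0∞)⁻¹ := by
  by_contra! hcon
  refine hpriv ⟨fun w i => center (p (moveThr (w.1 (κ (lateTimes K n w.1) i)))), ?_,
    hcon.trans_le ?_⟩
  · refine measurable_pi_iff.2 fun i => ?_
    have : Measurable fun Q : ℕ → Move d =>
        center (p (moveThr (Q (κ (lateTimes K n Q) i)))) := by
      intro U hU
      have : (fun Q : ℕ → Move d => center (p (moveThr (Q (κ (lateTimes K n Q) i))))) ⁻¹' U =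
          ⋃ r, {Q : ℕ → Move d | lateTimes K n Q = r} ∩
            {Q | center (p (moveThr (Q (κ r i)))) ∈ U} := by
        ext Q
        simp
      rw [this]
      refine MeasurableSet.iUnion fun r => (measurableSet_lateTimes_eq K n r).inter ?_
      exact (measurable_from_nat.comp (hp.comp (measurable_moveThr.comp
        (measurable_pi_apply (X := fun _ : ℕ => Move d) (κ r i))))) hU
    exact this.comp measurable_fst
  · set S := {z : (Fin d → I) × I | ∀ i,
      p (moveThr (φ.queries z.1 z.2 (κ (lateTimes K n (φ.queries z.1 z.2)) i))) = p (z.1 i)}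
    have h0 : 0 ≤ δ / 2 := (abs_nonneg _).trans (hc 0)
    have hS : volume (S ×ˢ (Set.univ : Set I)) = volume S * volume (Set.univ : Set I) :=
      Measure.prod_prod _ _
    calc volume S = volume (S ×ˢ (Set.univ : Set I)) := by rw [hS, measure_univ, mul_one]
      _ ≤ _ := by
          refine measure_mono fun w hw => ?_
          refine (pi_norm_le_iff_of_nonneg h0).2 fun i => ?_
          have := hw.1 i
          simp only [Pi.sub_apply, this, Real.norm_eq_abs]
          exact hc _

open Classical in
/-- On average over the true value and the seed, the best bet wins at least as often as a uniformly
random choice of late queries, one for each coordinate. -/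
lemma IsPrivate.lintegral_prod_le (hd : d ≠ 0) (hpriv : φ.IsPrivate δ L) (hp : Measurable p)
    {center : ℕ → ℝ} (hc : ∀ t : I, |center (p t) - t| ≤ δ / 2) (K n : ℕ) :
    ∫⁻ z : (Fin d → I) × I, ((∏ i, ((lateTimes K n (φ.queries z.1 z.2) i).filter
      (fun k => p (moveThr (φ.queries z.1 z.2 k)) = p (z.1 i))).card : ℕ) : ℝ≥0∞) ≤
      ENNReal.ofReal ((n - d * K : ℝ) / d) ^ d * (L : ℝ≥0∞)⁻¹ := by
  set R : (Fin d → I) × I → Fin d → Finset ℕ := fun z => lateTimes K n (φ.queries z.1 z.2) with hR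
  set Rs : Finset (Fin d → Finset ℕ) :=
    Fintype.piFinset (fun _ : Fin d => (Finset.range n).powerset) with hRs
  have hRmem : ∀ z, R z ∈ Rs := fun z => Fintype.mem_piFinset.2 fun i =>
    Finset.mem_powerset.2 (Finset.filter_subset _ _)
  set E : (Fin d → Finset ℕ) → (Fin d → ℕ) → Set ((Fin d → I) × I) := fun r κ =>
    {z | R z = r} ∩ {z | ∀ i, p (moveThr (φ.queries z.1 z.2 (κ i))) = p (z.1 i)} with hE
  have hEmeas : ∀ r κ, MeasurableSet (E r κ) := fun r κ => by
    refine (φ.measurable_queries_pi (measurableSet_lateTimes_eq K n r)).inter ?_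
    have : {z : (Fin d → I) × I | ∀ i, p (moveThr (φ.queries z.1 z.2 (κ i))) = p (z.1 i)} =
        ⋂ i, {z | p (moveThr (φ.queries z.1 z.2 (κ i))) = p (z.1 i)} := by
      ext; simp
    rw [this]
    exact MeasurableSet.iInter fun i => measurableSet_eq_fun
      (hp.comp (measurable_moveThr.comp (φ.measurable_queries (κ i))))
      (hp.comp ((measurable_pi_apply i).comp measurable_fst))
  have hF : ∀ z : (Fin d → I) × I, ((∏ i, ((R z i).filter
      (fun k => p (moveThr (φ.queries z.1 z.2 k)) = p (z.1 i))).card : ℕ) : ℝ≥0∞) =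
      ∑ r ∈ Rs, ∑ κ ∈ Fintype.piFinset r, (E r κ).indicator 1 z := by
    intro z
    rw [Finset.sum_eq_single_of_mem (R z) (hRmem z), ← Fintype.card_piFinset]
    · have : Fintype.piFinset (fun i => (R z i).filter
          (fun k => p (moveThr (φ.queries z.1 z.2 k)) = p (z.1 i))) =
          (Fintype.piFinset (R z)).filter (fun κ => ∀ i,
            p (moveThr (φ.queries z.1 z.2 (κ i))) = p (z.1 i)) := by
        ext κ
        simp [Fintype.mem_piFinset, forall_and]
      rw [this, Finset.card_filter, Nat.cast_sum]
      refine Finset.sum_congr rfl fun κ _ => ?_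
      rw [Set.indicator_apply]
      simp [hE]
    · intro r _ hr
      refine Finset.sum_eq_zero fun κ _ => Set.indicator_of_notMem ?_ _
      rintro ⟨h, -⟩
      exact hr h.symm
  -- For every configuration of late times, some choice of times is at least as good as the average.
  have hbest : ∀ r : Fin d → Finset ℕ, ∃ κ, ∑ κ' ∈ Fintype.piFinset r, volume (E r κ') ≤
      (Fintype.piFinset r).card * volume (E r κ) := by
    intro r
    rcases (Fintype.piFinset r).eq_empty_or_nonempty with h | h
    · exact ⟨fun _ => 0, by simp [h]⟩
    · obtain ⟨κ, -, hκ⟩ := Finset.exists_max_image _ (fun κ => volume (E r κ)) h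
      exact ⟨κ, by simpa using Finset.sum_le_card_nsmul _ _ _ hκ⟩
  choose κ hκ using hbest
  calc _ = ∫⁻ z, ∑ r ∈ Rs, ∑ κ ∈ Fintype.piFinset r, (E r κ).indicator 1 z := lintegral_congr hF
    _ = ∑ r ∈ Rs, ∑ κ ∈ Fintype.piFinset r, volume (E r κ) := by
        rw [lintegral_finsetSum _ fun r _ => Finset.measurable_sum _ fun κ _ =>
          measurable_one.indicator (hEmeas r κ)]
        refine Finset.sum_congr rfl fun r _ => ?_
        rw [lintegral_finsetSum _ fun κ _ => measurable_one.indicator (hEmeas r κ)]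
        exact Finset.sum_congr rfl fun κ _ => lintegral_indicator_one (hEmeas r κ)
    _ ≤ ∑ r ∈ Rs, ENNReal.ofReal ((n - d * K : ℝ) / d) ^ d * volume (E r (κ r)) := by
        refine Finset.sum_le_sum fun r _ => (hκ r).trans ?_
        by_cases h : ∃ z, R z = r
        · obtain ⟨z, rfl⟩ := h
          gcongr
          exact card_piFinset_lateTimes_le hd K n _
        · have : E r (κ r) = ∅ := Set.eq_empty_of_forall_notMem fun z hz => h ⟨z, hz.1⟩
          simp [this]
    _ = ENNReal.ofReal ((n - d * K : ℝ) / d) ^ d * volume (⋃ r ∈ Rs, E r (κ r)) := by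
        rw [← Finset.mul_sum, measure_biUnion_finset _ fun r _ => hEmeas r _]
        intro r _ r' _ hrr
        refine Set.disjoint_left.2 fun z hz hz' => hrr ?_
        exact hz.1.symm.trans hz'.1
    _ ≤ _ := by
        gcongr
        refine le_trans (measure_mono fun z hz => ?_) (hpriv.volume_bet_le hp hc K n κ)
        obtain ⟨r, -, hr, hz⟩ := Set.mem_iUnion₂.1 hz
        rw [Set.mem_ofPred_eq] at hr hz ⊢
        subst hr
        exact hz

/-- For a separable strategy, the numbers of late hits on the coordinates are independent given the
seed, so that the entropy bound for each coordinate multiplies up. -/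
lemma le_lintegral_prod {n K J : ℕ} (hε : 0 < ε) (hsep : φ.Separable) (hacc : φ.Accurate ε)
    (hn : φ.SubmitsAtMost n) (hp : Monotone p) (hJ : ∀ t, p t < J)
    (hc : 0 ≤ -Real.logb 2 (ε * (J + 2 ^ K - 1 : ℝ))) :
    ENNReal.ofReal (-Real.logb 2 (ε * (J + 2 ^ K - 1 : ℝ))) ^ d ≤
      ∫⁻ z : (Fin d → I) × I, ((∏ i, ((lateTimes K n (φ.queries z.1 z.2) i).filter
      (fun k => p (moveThr (φ.queries z.1 z.2 k)) = p (z.1 i))).card : ℕ) : ℝ≥0∞) := by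
  obtain ⟨Y, ψ, -, -, -, hψ⟩ := hsep
  have hs : ∀ y, φ.SplitsAs y (fun i h => ψ i h (Y i y)) := fun y x k => hψ x y k
  set F : (Fin d → I) × I → ℝ≥0∞ := fun z => ((∏ i, ((lateTimes K n (φ.queries z.1 z.2) i).filter
      (fun k => p (moveThr (φ.queries z.1 z.2 k)) = p (z.1 i))).card : ℕ) : ℝ≥0∞) with hF
  have hFmeas : Measurable F := by
    refine measurable_from_nat.comp (Finset.measurable_prod _ fun i _ => ?_)
    have : (fun z : (Fin d → I) × I => ((lateTimes K n (φ.queries z.1 z.2) i).filter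
        (fun k => p (moveThr (φ.queries z.1 z.2 k)) = p (z.1 i))).card) =
        fun z => ∑ k ∈ Finset.range n, ({z : (Fin d → I) × I | k ∈ lateTimes K n
          (φ.queries z.1 z.2) i} ∩ {z | p (moveThr (φ.queries z.1 z.2 k)) = p (z.1 i)}).indicator
            (fun _ => 1) z := by
      ext z
      have : (lateTimes K n (φ.queries z.1 z.2) i).filter
        (fun k => p (moveThr (φ.queries z.1 z.2 k)) = p (z.1 i)) = (Finset.range n).filter
          (fun k => k ∈ lateTimes K n (φ.queries z.1 z.2) i ∧
            p (moveThr (φ.queries z.1 z.2 k)) = p (z.1 i)) := by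
        ext k
        simp only [Finset.mem_filter, lateTimes]
        tauto
      rw [this, Finset.card_filter]
      classical
      refine Finset.sum_congr rfl fun k _ => ?_
      rw [Set.indicator_apply]
      rfl
    rw [this]
    refine Finset.measurable_sum _ fun k _ => measurable_const.indicator (MeasurableSet.inter ?_ ?_)
    · exact φ.measurable_queries_pi (measurableSet_mem_lateTimes K n k i)
    · exact measurableSet_eq_fun
        (hp.measurable.comp (measurable_moveThr.comp (φ.measurable_queries k)))
        (hp.measurable.comp ((measurable_pi_apply i).comp measurable_fst))
  rw [Measure.volume_eq_prod, lintegral_prod_symm' _ hFmeas]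
  calc _ = ∫⁻ _ : I, ENNReal.ofReal (-Real.logb 2 (ε * (J + 2 ^ K - 1 : ℝ))) ^ d := by simp
    _ ≤ _ := by
      refine lintegral_mono_ae ?_
      filter_upwards [hacc.ae_final hn] with y hy
      set h : Fin d → I → ℝ := fun i t => hits (fun h => ψ i h (Y i y)) p K n t with hh
      have hprod : ∀ x, F (x, y) = ENNReal.ofReal (∏ i, h i (x i)) := by
        intro x
        simp only [hF, hh]
        rw [← Nat.cast_prod, ENNReal.ofReal_natCast]
        congr 1
        exact Finset.prod_congr rfl fun i _ => (hs y).card_lateTimes_eq_hits hn p K x i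
      have hint : ∀ i, Integrable (h i) volume := fun i => by
        refine Integrable.of_bound (measurable_from_nat.comp
          (measurable_hits hp)).aestronglyMeasurable n (ae_of_all _ fun t => ?_)
        simpa [hh] using hits_le _ p K n t
      have hle : ∀ i, -Real.logb 2 (ε * (J + 2 ^ K - 1 : ℝ)) ≤ ∫ t, h i t := fun i =>
        le_integral_hits hε hp ((hs y).volume_leaf_le hy i) K hJ
      simp_rw [hprod]
      have hintprod : Integrable (fun x : Fin d → I => ∏ i, h i (x i)) volume :=
        Integrable.fintype_prod hint
      rw [← ofReal_integral_eq_lintegral_ofReal hintprod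
        (ae_of_all _ fun x => Finset.prod_nonneg fun i _ => Nat.cast_nonneg _),
        ← ENNReal.ofReal_pow hc]
      refine ENNReal.ofReal_le_ofReal ?_
      rw [integral_fintype_prod_volume_eq_prod]
      calc _ = ∏ _i : Fin d, -Real.logb 2 (ε * (J + 2 ^ K - 1 : ℝ)) := by simp
        _ ≤ _ := Finset.prod_le_prod (fun _ _ => hc) fun i _ => hle i

end Strategy

/-! ### The lower bound -/

/-- A partition of `[0,1]` into `⌈1 / δ⌉` consecutive intervals of length at most `δ`: the index of
the interval of `t`. The point `1` is put into the last interval. -/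
noncomputable def piece (δ : ℝ) (t : I) : ℕ := min ⌊(t : ℝ) / δ⌋₊ (⌈1 / δ⌉₊ - 1)

lemma piece_mono {δ : ℝ} (hδ : 0 < δ) : Monotone (piece δ) := fun s t hst =>
  min_le_min_right _ (Nat.floor_le_floor (by gcongr))

lemma piece_lt {δ : ℝ} (hδ : 0 < δ) (t : I) : piece δ t < ⌈1 / δ⌉₊ := by
  have : 0 < ⌈1 / δ⌉₊ := Nat.ceil_pos.2 (by positivity)
  exact (min_le_right _ _).trans_lt (by omega)

lemma abs_center_piece_sub_le {δ : ℝ} (hδ : 0 < δ) (t : I) :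
    |((piece δ t : ℝ) + 1 / 2) * δ - t| ≤ δ / 2 := by
  have h0 : 0 ≤ (t : ℝ) / δ := div_nonneg t.2.1 hδ.le
  have h1 := Nat.floor_le h0
  have h2 := Nat.lt_floor_add_one ((t : ℝ) / δ)
  rw [le_div_iff₀ hδ] at h1
  rw [div_lt_iff₀ hδ] at h2
  have hJ : 0 < ⌈1 / δ⌉₊ := Nat.ceil_pos.2 (by positivity)
  have h3 := Nat.le_ceil (1 / δ)
  rw [div_le_iff₀ hδ] at h3
  have ht := t.2.2
  rw [abs_le, piece]
  rcases le_total ⌊(t : ℝ) / δ⌋₊ (⌈1 / δ⌉₊ - 1) with h | h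
  · rw [min_eq_left h]
    constructor <;> linarith
  · rw [min_eq_right h]
    have h4 : ((⌈1 / δ⌉₊ - 1 : ℕ) : ℝ) * δ ≤ ⌊(t : ℝ) / δ⌋₊ * δ := by gcongr
    rw [Nat.cast_sub hJ, Nat.cast_one] at h4 ⊢
    constructor <;> linarith

lemma gam_pow {L d : ℕ} (hd : 1 ≤ d) : gam L d ^ d = L := by
  rw [gam, one_div, Real.rpow_inv_natCast_pow (Nat.cast_nonneg _) (by omega)]

lemma one_lt_gam {L d : ℕ} (hd : 1 ≤ d) (hL : 2 ≤ L) : 1 < gam L d :=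
  Real.one_lt_rpow (by exact_mod_cast hL) (by positivity)

lemma ceil_gam_mul_le_one {L d : ℕ} (hd : 1 ≤ d) (hL : 2 ≤ L) {δ : ℝ}
    (hδ : δ ≤ 1 / (⌈gam L d⌉ : ℝ)) : (⌈gam L d⌉ : ℝ) * δ ≤ 1 := by
  have : 0 < (⌈gam L d⌉ : ℝ) := (zero_lt_one.trans (one_lt_gam hd hL)).trans_le (Int.le_ceil _)
  rwa [le_div_iff₀' this] at hδ

/-- The entropy bound, applied with `⌊log₂ (1 / (γ δ))⌋` uncounted levels, against the winning
probability of the adversary that bets on late queries. -/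
theorem Strategy.Separable.le_of_submitsAtMost {L : ℕ} (hd : 1 ≤ d) (hL : 2 ≤ L) {ε δ : ℝ}
    (hε : 0 < ε) (hεδ : 2 * ε ≤ δ) (hδ : δ ≤ 1 / (⌈gam L d⌉ : ℝ)) {φ : Strategy d} {n : ℕ}
    (hsep : φ.Separable) (hacc : φ.Accurate ε) (hpriv : φ.IsPrivate δ L)
    (hn : φ.SubmitsAtMost n) :
    (d : ℝ) * ((⌊Real.logb 2 (1 / (gam L d * δ))⌋ : ℝ)
      + gam L d * (Real.logb 2 (δ / ε) - 2) - 1) ≤ n := by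
  have hδ0 : 0 < δ := by linarith
  have hγ := one_lt_gam hd hL
  set γ := gam L d with hγdef
  have hγδ : γ * δ ≤ 1 :=
    (mul_le_mul_of_nonneg_right (Int.le_ceil γ) hδ0.le).trans (ceil_gam_mul_le_one hd hL hδ)
  have hγδ0 : 0 < γ * δ := by positivity
  have hlog0 : 0 ≤ Real.logb 2 (1 / (γ * δ)) :=
    Real.logb_nonneg one_lt_two ((one_le_div hγδ0).2 hγδ)
  obtain ⟨K, hK⟩ := Int.eq_ofNat_of_zero_le (Int.floor_nonneg.2 hlog0)
  have hKle : (2 : ℝ) ^ K ≤ 1 / (γ * δ) := by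
    have h1 : (K : ℝ) ≤ Real.logb 2 (1 / (γ * δ)) := by
      have := Int.floor_le (Real.logb 2 (1 / (γ * δ)))
      rw [hK] at this
      exact_mod_cast this
    rwa [Real.le_logb_iff_rpow_le one_lt_two (by positivity), Real.rpow_natCast] at h1
  set J := ⌈1 / δ⌉₊ with hJdef
  have hJ0 : (1 : ℝ) ≤ J := by
    have : 0 < ⌈1 / δ⌉₊ := Nat.ceil_pos.2 (by positivity)
    exact_mod_cast this
  have hJlt : (J : ℝ) < 1 / δ + 1 := Nat.ceil_lt_add_one (by positivity)
  -- The first `K` levels and the pieces make fewer than `2 / δ` cells.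
  have hcells : ε * (J + 2 ^ K - 1 : ℝ) < 2 * ε / δ := by
    have h1 : 1 / (γ * δ) ≤ 1 / δ := one_div_le_one_div_of_le hδ0 (by nlinarith)
    have h2 : (J + 2 ^ K - 1 : ℝ) < 2 * (1 / δ) := by linarith
    calc ε * (J + 2 ^ K - 1 : ℝ) < ε * (2 * (1 / δ)) := by gcongr
      _ = _ := by ring
  have hcells0 : 0 < ε * (J + 2 ^ K - 1 : ℝ) := by
    have : (0 : ℝ) < 2 ^ K := by positivity
    exact mul_pos hε (by linarith)
  set c := -Real.logb 2 (ε * (J + 2 ^ K - 1 : ℝ)) with hcdef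
  have hclt : Real.logb 2 (δ / ε) - 1 < c := by
    have h1 := Real.logb_lt_logb one_lt_two hcells0 hcells
    have h2 : 2 * ε / δ = 2 / (δ / ε) := by field_simp
    rw [h2, Real.logb_div (by norm_num) (by positivity), Real.logb_self_eq_one one_lt_two] at h1
    linarith
  have hlog1 : 1 ≤ Real.logb 2 (δ / ε) := by
    rw [Real.le_logb_iff_rpow_le one_lt_two (by positivity), Real.rpow_one, le_div_iff₀ hε]
    exact hεδ
  have hc0 : 0 < c := by linarith
  have hmain := (Strategy.le_lintegral_prod hε hsep hacc hn (piece_mono hδ0) (piece_lt hδ0)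
    hc0.le).trans (hpriv.lintegral_prod_le (by omega) (piece_mono hδ0).measurable
      (center := fun j => ((j : ℝ) + 1 / 2) * δ) (abs_center_piece_sub_le hδ0) K n)
  rw [← hcdef] at hmain
  have hL0 : (L : ℝ≥0∞) ≠ 0 := by
    have : L ≠ 0 := by omega
    exact_mod_cast this
  have hmain2 : ENNReal.ofReal ((c * γ) ^ d) ≤ ENNReal.ofReal ((n - d * K : ℝ) / d) ^ d := by
    rw [mul_pow, gam_pow hd, ENNReal.ofReal_mul (by positivity), ENNReal.ofReal_natCast,
      ENNReal.ofReal_pow hc0.le]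
    calc _ ≤ ENNReal.ofReal ((n - d * K : ℝ) / d) ^ d * (L : ℝ≥0∞)⁻¹ * L := by gcongr
      _ = _ := by rw [mul_assoc, ENNReal.inv_mul_cancel hL0 (by simp), mul_one]
  rw [ENNReal.ofReal_pow (by positivity)] at hmain2
  have hmain3 := (ENNReal.pow_le_pow_left_iff (by omega)).1 hmain2
  rw [ENNReal.ofReal_le_ofReal_iff'] at hmain3
  have hdpos : (0 : ℝ) < d := by exact_mod_cast hd
  have hmain4 : c * γ ≤ (n - d * K : ℝ) / d :=
    hmain3.resolve_right (not_le.2 (by positivity))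
  rw [le_div_iff₀' hdpos] at hmain4
  have h5 : γ * (Real.logb 2 (δ / ε) - 2) ≤ c * γ := by nlinarith
  have h6 : (d : ℝ) * (γ * (Real.logb 2 (δ / ε) - 2)) ≤ d * (c * γ) := by gcongr
  rw [hK, Int.cast_natCast]
  linarith

/-! ### Threshold schemes on a finite grid -/

/-- A deterministic scheme that locates an unknown `v < W` by `N` queries "is `v ≥ q`?" with natural
thresholds. `thr v n` is the threshold of query number `n` when the unknown is `v`; it must be
determined by the earlier thresholds and responses. -/
structure Scheme (W N : ℕ) where
  /-- the threshold of query number `n` when the unknown is `v` -/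
  thr : ℕ → ℕ → ℕ
  thr_lt : ∀ {v n}, v < W → n < N → thr v n < W
  thr_congr : ∀ {v v' n}, v < W → v' < W → n < N →
    (∀ k < n, thr v k = thr v' k ∧ (thr v k ≤ v ↔ thr v' k ≤ v')) → thr v n = thr v' n
  eq_of_forall : ∀ {v v'}, v < W → v' < W →
    (∀ k < N, thr v k = thr v' k ∧ (thr v k ≤ v ↔ thr v' k ≤ v')) → v = v'

/-- The threshold of one bisection step: the midpoint of the block of length `2 * b` of `v`. -/
def bisect (b v : ℕ) : ℕ := v / (2 * b) * (2 * b) + b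

lemma div_mul_add_lt {c W v r : ℕ} (hc : c ∣ W) (hv : v < W) (hr : r < c) :
    v / c * c + r < W := by
  obtain ⟨e, rfl⟩ := hc
  have h1 : v / c < e := Nat.div_lt_of_lt_mul hv
  calc v / c * c + r < v / c * c + c := by omega
    _ = (v / c + 1) * c := by ring
    _ ≤ e * c := Nat.mul_le_mul_right _ h1
    _ = c * e := mul_comm _ _

lemma bisect_lt {b W v : ℕ} (hb : 0 < b) (hc : 2 * b ∣ W) (hv : v < W) : bisect b v < W :=
  div_mul_add_lt hc hv (by omega)

lemma bisect_congr {b v v' : ℕ} (h : v / (2 * b) = v' / (2 * b)) : bisect b v = bisect b v' := by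
  rw [bisect, bisect, h]


lemma div_eq_of_bisect {b v v' : ℕ} (hb : 0 < b) (h : v / (2 * b) = v' / (2 * b))
    (h' : bisect b v ≤ v ↔ bisect b v' ≤ v') : v / b = v' / b := by
  have key : ∀ v, v / b = 2 * (v / (2 * b)) + if bisect b v ≤ v then 1 else 0 := by
    intro v
    have h1 := Nat.div_add_mod v (2 * b)
    have h2 := Nat.mod_lt v (show 0 < 2 * b by omega)
    have e : 2 * b * (v / (2 * b)) = 2 * (v / (2 * b)) * b := by ring
    have e' : v / (2 * b) * (2 * b) = 2 * (v / (2 * b)) * b := by ring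
    rw [Nat.div_eq_iff hb, bisect]
    split_ifs with hle
    · rw [add_mul]; omega
    · rw [add_zero]; omega
  rw [key v, key v', h]
  simp only [h']

/-- The thresholds of the replicated bisection on a grid of `2 ^ K * (G * 2 ^ M)` points: `K` steps
of bisection find the block of length `G * 2 ^ M` of `v`; then `G - 1` queries find the sub-block of
length `2 ^ M` of `v`; and then `M` steps of bisection are carried out in all of the `G` sub-blocks
in parallel, with the same relative thresholds in each of them. -/
def repThr (K G M v n : ℕ) : ℕ :=
  if n < K then bisect (G * 2 ^ M * 2 ^ (K - 1 - n)) v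
  else if n < K + (G - 1) then v / (G * 2 ^ M) * (G * 2 ^ M) + (n - K + 1) * 2 ^ M
  else v / (G * 2 ^ M) * (G * 2 ^ M) + ((n - (K + (G - 1))) % G * 2 ^ M +
    bisect (2 ^ (M - 1 - (n - (K + (G - 1))) / G)) (v % 2 ^ M))

section RepThr

variable {K G M v v' n : ℕ}

lemma two_mul_two_pow {a b : ℕ} (h : a = b + 1) : 2 * 2 ^ b = 2 ^ a := by
  rw [h, pow_succ']

lemma repThr_lt (hG : 0 < G) (hv : v < 2 ^ K * (G * 2 ^ M)) (hn : n < K + (G - 1) + G * M) :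
    repThr K G M v n < 2 ^ K * (G * 2 ^ M) := by
  have hM : 0 < 2 ^ M := by positivity
  rw [repThr]
  split_ifs with h1 h2
  · refine bisect_lt (by positivity) ⟨2 ^ n, ?_⟩ hv
    have : 2 ^ K = 2 * 2 ^ (K - 1 - n) * 2 ^ n := by
      rw [two_mul_two_pow (a := K - n) (by omega), ← pow_add]; congr 1; omega
    rw [this]; ring
  · refine div_mul_add_lt (Dvd.intro_left _ rfl) hv ?_
    exact Nat.mul_lt_mul_of_pos_right (by omega) hM
  · refine div_mul_add_lt (Dvd.intro_left _ rfl) hv ?_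
    have hl : (n - (K + (G - 1))) / G < M := Nat.div_lt_of_lt_mul (by omega)
    have hp := Nat.mod_lt (n - (K + (G - 1))) hG
    set l := (n - (K + (G - 1))) / G
    have hb : bisect (2 ^ (M - 1 - l)) (v % 2 ^ M) < 2 ^ M := by
      refine bisect_lt (by positivity) ⟨2 ^ l, ?_⟩ (Nat.mod_lt _ hM)
      rw [two_mul_two_pow (a := M - l) (by omega), ← pow_add]; congr 1; omega
    calc _ < (n - (K + (G - 1))) % G * 2 ^ M + 2 ^ M := by omega
      _ = ((n - (K + (G - 1))) % G + 1) * 2 ^ M := by ring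
      _ ≤ G * 2 ^ M := Nat.mul_le_mul_right _ hp

/-- The thresholds do not reveal the sub-block of `v`. -/
lemma repThr_congr_of_code (h1 : v / (G * 2 ^ M) = v' / (G * 2 ^ M))
    (h2 : v % 2 ^ M = v' % 2 ^ M) (n : ℕ) : repThr K G M v n = repThr K G M v' n := by
  rw [repThr, repThr, h1, h2]
  split_ifs
  · refine bisect_congr ?_
    rw [mul_left_comm, ← Nat.div_div_eq_div_mul v, ← Nat.div_div_eq_div_mul v', h1]
  · rfl
  · rfl

lemma div_eq_of_forall_repThr (hG : 0 < G) (h : ∀ k < n, repThr K G M v k = repThr K G M v' k ∧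
      (repThr K G M v k ≤ v ↔ repThr K G M v' k ≤ v')) {k : ℕ} (hkn : k ≤ n) (hkK : k ≤ K)
    (hv : v < 2 ^ K * (G * 2 ^ M)) (hv' : v' < 2 ^ K * (G * 2 ^ M)) :
    v / (G * 2 ^ M * 2 ^ (K - k)) = v' / (G * 2 ^ M * 2 ^ (K - k)) := by
  induction k with
  | zero =>
    rw [Nat.sub_zero, mul_comm, Nat.div_eq_of_lt hv, Nat.div_eq_of_lt hv']
  | succ k ih =>
    have h1 := (h k (by omega)).2
    rw [repThr, repThr, if_pos (by omega), if_pos (by omega)] at h1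
    have e : K - 1 - k = K - (k + 1) := by omega
    have e2 : 2 * (G * 2 ^ M * 2 ^ (K - (k + 1))) = G * 2 ^ M * 2 ^ (K - k) := by
      rw [← two_mul_two_pow (a := K - k) (b := K - (k + 1)) (by omega)]; ring
    rw [e] at h1
    refine div_eq_of_bisect (by positivity) ?_ h1
    rw [e2]
    exact ih (by omega) (by omega)

lemma div_two_pow_eq_of_forall_repThr (hG : 0 < G)
    (h : ∀ k < n, repThr K G M v k = repThr K G M v' k ∧
      (repThr K G M v k ≤ v ↔ repThr K G M v' k ≤ v')) (hn : K + (G - 1) ≤ n)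
    (hv : v < 2 ^ K * (G * 2 ^ M)) (hv' : v' < 2 ^ K * (G * 2 ^ M)) :
    v / 2 ^ M = v' / 2 ^ M := by
  have hM : 0 < 2 ^ M := by positivity
  have hB := div_eq_of_forall_repThr hG h (k := K) (by omega) le_rfl hv hv'
  rw [Nat.sub_self, pow_zero, mul_one] at hB
  set a := v / (G * 2 ^ M) with ha
  have hdiv : ∀ w : ℕ, w / (G * 2 ^ M) = w / 2 ^ M / G := fun w => by
    rw [mul_comm, Nat.div_div_eq_div_mul]
  have hq : ∀ j < G - 1, (a * G + (j + 1) ≤ v / 2 ^ M ↔ a * G + (j + 1) ≤ v' / 2 ^ M) := by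
    intro j hj
    have h1 := (h (K + j) (by omega)).2
    have n1 : ¬ K + j < K := by omega
    have n2 : K + j < K + (G - 1) := by omega
    rw [repThr, repThr, if_neg n1, if_neg n1, if_pos n2, if_pos n2, ← hB, ← ha,
      show K + j - K + 1 = j + 1 by omega,
      show a * (G * 2 ^ M) + (j + 1) * 2 ^ M = (a * G + (j + 1)) * 2 ^ M by ring] at h1
    rwa [Nat.le_div_iff_mul_le hM, Nat.le_div_iff_mul_le hM]
  have e1 : a * G ≤ v / 2 ^ M ∧ v / 2 ^ M < a * G + G := by
    have h1 := Nat.div_add_mod (v / 2 ^ M) G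
    have h2 := Nat.mod_lt (v / 2 ^ M) hG
    rw [← hdiv, ← ha, mul_comm] at h1
    omega
  have e2 : a * G ≤ v' / 2 ^ M ∧ v' / 2 ^ M < a * G + G := by
    have h1 := Nat.div_add_mod (v' / 2 ^ M) G
    have h2 := Nat.mod_lt (v' / 2 ^ M) hG
    rw [← hdiv, ← hB, mul_comm] at h1
    omega
  rcases lt_trichotomy (v / 2 ^ M) (v' / 2 ^ M) with hlt | heq | hlt
  · have := hq (v' / 2 ^ M - a * G - 1) (by omega)
    omega
  · exact heq
  · have := hq (v / 2 ^ M - a * G - 1) (by omega)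
    omega

lemma mod_two_pow_div_eq {l : ℕ} (hl : l ≤ M) (h : v / 2 ^ (M - l) = v' / 2 ^ (M - l)) :
    v % 2 ^ M / 2 ^ (M - l) = v' % 2 ^ M / 2 ^ (M - l) := by
  have : 2 ^ M = 2 ^ (M - l) * 2 ^ l := by rw [← pow_add]; congr 1; omega
  rw [this, Nat.mod_mul_right_div_self, Nat.mod_mul_right_div_self, h]

/-- In the sub-block of the true value, the replicated bisection is a bisection. -/
lemma div_two_pow_sub_eq_of_forall_repThr (hG : 0 < G)
    (h : ∀ k < n, repThr K G M v k = repThr K G M v' k ∧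
      (repThr K G M v k ≤ v ↔ repThr K G M v' k ≤ v')) {l : ℕ} (hl : l ≤ M)
    (hn : K + (G - 1) + G * l ≤ n)
    (hv : v < 2 ^ K * (G * 2 ^ M)) (hv' : v' < 2 ^ K * (G * 2 ^ M)) :
    v / 2 ^ (M - l) = v' / 2 ^ (M - l) := by
  induction l with
  | zero => exact div_two_pow_eq_of_forall_repThr hG h (by omega) hv hv'
  | succ l ih =>
    rw [mul_add, mul_one] at hn
    have ih := ih (by omega) (by omega)
    have hS := div_two_pow_eq_of_forall_repThr hG h (by omega) hv hv'
    have e1 : M - 1 - l = M - (l + 1) := by omega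
    have e2 : 2 * 2 ^ (M - (l + 1)) = 2 ^ (M - l) := two_mul_two_pow (by omega)
    have hM : 2 ^ M = 2 ^ (M - l) * 2 ^ l := by rw [← pow_add]; congr 1; omega
    -- The query number `K + (G - 1) + G * l + p` bisects in the sub-block number `p` of the block.
    have hthr : ∀ w : ℕ, repThr K G M w (K + (G - 1) + (G * l + w / 2 ^ M % G)) =
        bisect (2 ^ (M - (l + 1))) w := by
      intro w
      have hp := Nat.mod_lt (w / 2 ^ M) hG
      have e3 : (G * l + w / 2 ^ M % G) / G = l := by
        rw [Nat.mul_add_div hG, Nat.div_eq_of_lt hp, add_zero]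
      rw [repThr, if_neg (by omega), if_neg (by omega), Nat.add_sub_cancel_left, e3,
        Nat.mul_add_mod, Nat.mod_mod, e1, bisect, bisect, e2]
      have h1 := Nat.div_add_mod w (2 ^ M)
      have h2 := Nat.div_add_mod (w / 2 ^ M) G
      have h3 : w / (G * 2 ^ M) = w / 2 ^ M / G := by rw [mul_comm, Nat.div_div_eq_div_mul]
      have h4 : w / 2 ^ (M - l) = 2 ^ l * (w / 2 ^ M) + w % 2 ^ M / 2 ^ (M - l) := by
        calc w / 2 ^ (M - l) = (2 ^ (M - l) * (2 ^ l * (w / 2 ^ M)) + w % 2 ^ M) / 2 ^ (M - l) := by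
              rw [← mul_assoc, ← hM, h1]
          _ = _ := Nat.mul_add_div (by positivity) _ _
      rw [h3, h4, add_mul, ← add_assoc, ← add_assoc]
      congr 2
      calc _ = (G * (w / 2 ^ M / G) + w / 2 ^ M % G) * 2 ^ M := by ring
        _ = _ := by rw [h2, hM]; ring
    have hp := Nat.mod_lt (v / 2 ^ M) hG
    have h1 := (h (K + (G - 1) + (G * l + v / 2 ^ M % G)) (by omega)).2
    rw [hthr v, hS, hthr v'] at h1
    exact div_eq_of_bisect (by positivity) (by rw [e2]; exact ih) h1

end RepThr

/-- The replicated bisection as a scheme. -/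
def repScheme (K : ℕ) {G : ℕ} (M : ℕ) (hG : 0 < G) :
    Scheme (2 ^ K * (G * 2 ^ M)) (K + (G - 1) + G * M) where
  thr := repThr K G M
  thr_lt hv hn := repThr_lt hG hv hn
  thr_congr {v v' n} hv hv' hn h := by
    rw [repThr, repThr]
    split_ifs with h1 h2
    · have := div_eq_of_forall_repThr hG h le_rfl h1.le hv hv'
      refine bisect_congr ?_
      rw [mul_left_comm, two_mul_two_pow (a := K - n) (by omega)]
      exact this
    · have hB := div_eq_of_forall_repThr hG h (k := K) (by omega) le_rfl hv hv'
      rw [Nat.sub_self, pow_zero, mul_one] at hB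
      rw [hB]
    · have hB := div_eq_of_forall_repThr hG h (k := K) (by omega) le_rfl hv hv'
      rw [Nat.sub_self, pow_zero, mul_one] at hB
      have hlM : (n - (K + (G - 1))) / G < M := Nat.div_lt_of_lt_mul (by omega)
      have hle := Nat.mul_div_le (n - (K + (G - 1))) G
      have hl := div_two_pow_sub_eq_of_forall_repThr hG h hlM.le (by omega) hv hv'
      have hb : bisect (2 ^ (M - 1 - (n - (K + (G - 1))) / G)) (v % 2 ^ M) =
          bisect (2 ^ (M - 1 - (n - (K + (G - 1))) / G)) (v' % 2 ^ M) := by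
        refine bisect_congr ?_
        rw [two_mul_two_pow (a := M - (n - (K + (G - 1))) / G) (by omega)]
        exact mod_two_pow_div_eq hlM.le hl
      rw [hB, hb]
  eq_of_forall {v v'} hv hv' h := by
    have := div_two_pow_sub_eq_of_forall_repThr hG h le_rfl le_rfl hv hv'
    rwa [Nat.sub_self, pow_zero, Nat.div_one, Nat.div_one] at this

/-! ### Strategies from threshold schemes -/

/-- The index of the cell of `t` in the grid of `W` cells of length `1 / W`. The point `1` is put
into the last cell. -/
noncomputable def gridIndex (W : ℕ) (t : I) : ℕ := min ⌊(t : ℝ) * W⌋₊ (W - 1)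

section GridIndex

variable {W q : ℕ} {t : I}

lemma gridIndex_lt (hW : 0 < W) (t : I) : gridIndex W t < W :=
  (min_le_right _ _).trans_lt (by omega)

lemma gridIndex_mono (W : ℕ) : Monotone (gridIndex W) := fun s t hst =>
  min_le_min_right _ (Nat.floor_le_floor (by gcongr))

lemma le_gridIndex_iff (hq : q < W) : q ≤ gridIndex W t ↔ (q : ℝ) / W ≤ t := by
  have hW : (0 : ℝ) < W := by exact_mod_cast (Nat.zero_le q).trans_lt hq
  rw [gridIndex, le_min_iff, Nat.le_floor_iff (mul_nonneg t.2.1 hW.le), div_le_iff₀ hW]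
  exact and_iff_left (by omega)

lemma gridIndex_div_le (hW : 0 < W) (t : I) : (gridIndex W t : ℝ) / W ≤ t :=
  (le_gridIndex_iff (gridIndex_lt hW t)).1 le_rfl

lemma le_gridIndex_add_one_div (hW : 0 < W) (t : I) : (t : ℝ) ≤ (gridIndex W t + 1) / W := by
  rcases lt_or_ge (gridIndex W t + 1) W with h | h
  · have := mt (le_gridIndex_iff (t := t) h).2 (by omega)
    push_cast at this
    exact (not_le.1 this).le
  · have hW' : (0 : ℝ) < W := by exact_mod_cast hW
    refine t.2.2.trans ((one_le_div hW').2 ?_)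
    exact_mod_cast h

end GridIndex

namespace Scheme

variable {W N : ℕ} (s : Scheme W N) {v v' n m : ℕ} {t : I} {d : ℕ}

/-- The first `n` responses when the unknown is `v`, the most recent one first. -/
def ans {W N : ℕ} (s : Scheme W N) (v : ℕ) : ℕ → List Bool
  | 0 => []
  | n + 1 => decide (s.thr v n ≤ v) :: ans s v n

@[simp] lemma length_ans (v n : ℕ) : (s.ans v n).length = n := by
  induction n with
  | zero => rfl
  | succ n ih => rw [ans, List.length_cons, ih]

variable {s} in
lemma forall_of_ans_eq (hv : v < W) (hv' : v' < W) (hn : n ≤ N) (h : s.ans v n = s.ans v' n) :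
    ∀ k < n, s.thr v k = s.thr v' k ∧ (s.thr v k ≤ v ↔ s.thr v' k ≤ v') := by
  induction n with
  | zero => intro k hk; omega
  | succ n ih =>
    rw [ans, ans, List.cons.injEq, decide_eq_decide] at h
    have ih := ih (by omega) h.2
    intro k hk
    rcases Nat.lt_succ_iff_lt_or_eq.1 hk with hk | rfl
    · exact ih k hk
    · exact ⟨s.thr_congr hv hv' hn ih, h.1⟩

open Classical in
/-- Some unknown that is compatible with a list of responses (`0` if there is none). -/
noncomputable def decode (h : List Bool) : ℕ :=
  if H : ∃ v < W, s.ans v h.length = h then H.choose else 0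

lemma decode_ans_spec (hv : v < W) :
    s.decode (s.ans v n) < W ∧ s.ans (s.decode (s.ans v n)) n = s.ans v n := by
  have H : ∃ v' < W, s.ans v' (s.ans v n).length = s.ans v n := ⟨v, hv, by rw [length_ans]⟩
  have h := H.choose_spec
  rw [decode, dif_pos H]
  generalize H.choose = c at h ⊢
  rwa [length_ans] at h

lemma thr_decode_ans (hv : v < W) (hn : n < N) :
    s.thr (s.decode (s.ans v n)) n = s.thr v n := by
  obtain ⟨h1, h2⟩ := s.decode_ans_spec (n := n) hv
  exact s.thr_congr h1 hv hn (forall_of_ans_eq h1 hv hn.le h2)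

lemma decode_ans (hv : v < W) : s.decode (s.ans v N) = v := by
  obtain ⟨h1, h2⟩ := s.decode_ans_spec (n := N) hv
  exact s.eq_of_forall h1 hv (forall_of_ans_eq h1 hv le_rfl h2)

/-- The threshold `q / W`, as a point of `[0,1]`. -/
noncomputable def gridPoint (W q : ℕ) : I := Set.projIcc 0 1 zero_le_one ((q : ℝ) / W)

lemma gridPoint_le_iff (hv : v < W) : gridPoint W v ≤ t ↔ v ≤ gridIndex W t := by
  have hW : (0 : ℝ) < W := by exact_mod_cast (Nat.zero_le v).trans_lt hv
  have hmem : (v : ℝ) / W ∈ Set.Icc (0 : ℝ) 1 :=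
    ⟨by positivity, (div_le_one hW).2 (by exact_mod_cast hv.le)⟩
  rw [le_gridIndex_iff hv, gridPoint, Set.projIcc_of_mem _ hmem]
  rfl

/-- The one-dimensional querying strategy that runs the scheme on the grid. -/
noncomputable def coord (h : List Bool) : I ⊕ Unit :=
  if h.length < N then Sum.inl (gridPoint W (s.thr (s.decode h) h.length)) else Sum.inr ()

lemma coord_ans_of_lt (hv : v < W) (hn : n < N) :
    s.coord (s.ans v n) = Sum.inl (gridPoint W (s.thr v n)) := by
  rw [coord, length_ans, if_pos hn, s.thr_decode_ans hv hn]

lemma run_coord (hW : 0 < W) (t : I) (hm : m ≤ N) :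
    run s.coord t m = s.ans (gridIndex W t) m := by
  induction m with
  | zero => rfl
  | succ m ih =>
    have ih := ih (by omega)
    have hv := gridIndex_lt hW t
    rw [run_succ_of_inl (q := gridPoint W (s.thr (gridIndex W t) m))
      (by rw [ih, s.coord_ans_of_lt hv hm]), ih, ans]
    congr 1
    rw [decide_eq_decide]
    exact gridPoint_le_iff (s.thr_lt hv hm)

lemma length_run_coord_le (t : I) (m : ℕ) : (run s.coord t m).length ≤ N := by
  induction m with
  | zero => exact Nat.zero_le _
  | succ m ih =>
    rcases h : s.coord (run s.coord t m) with q | u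
    · rw [run_succ_of_inl h, List.length_cons]
      rw [coord] at h
      split_ifs at h with h'
      exact h'
    · rw [run_succ_of_inr h]; exact ih

open Classical in
/-- Some coordinate on which fewer than `N` queries have been submitted, given the numbers of
queries submitted so far. -/
noncomputable def pick (N : ℕ) (ℓ : Fin d → ℕ) : Option (Fin d) :=
  if h : ∃ i, ℓ i < N then some h.choose else none

lemma pick_eq_some {ℓ : Fin d → ℕ} {i : Fin d} (h : pick N ℓ = some i) : ℓ i < N := by
  rw [pick] at h
  split_ifs at h with h'
  rw [← Option.some.inj h]
  exact h'.choose_spec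

lemma pick_eq_none {ℓ : Fin d → ℕ} (h : pick N ℓ = none) (i : Fin d) : N ≤ ℓ i := by
  rw [pick] at h
  split_ifs at h with h'
  exact not_lt.1 fun hi => h' ⟨i, hi⟩

/-- The strategy that runs the scheme separately on every coordinate and estimates each coordinate
by the center of its cell. -/
noncomputable def strategy (d : ℕ) : Strategy d where
  next H _ := (pick N fun i => (coordHist i H).length).elim (Sum.inr ())
    fun i => Sum.inl (i, gridPoint W (s.thr (s.decode (coordHist i H)) (coordHist i H).length))
  measurable_next _ := measurable_const
  est H _ i := ((s.decode (coordHist i H) : ℝ) + 1 / 2) / W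
  measurable_est _ := measurable_const

lemma strategy_splitsAs (y : I) : (s.strategy d).SplitsAs y fun _ => s.coord := by
  intro x k
  set H := (s.strategy d).hist x y k with hH
  have hq : (s.strategy d).queries x y k = (pick N fun i => (coordHist i H).length).elim
    (Sum.inr ()) fun i =>
      Sum.inl (i, gridPoint W (s.thr (s.decode (coordHist i H)) (coordHist i H).length)) := rfl
  rcases hp : pick N fun i => (coordHist i H).length with _ | j
  · rw [hq, hp]
    refine ⟨fun i q h => by simp at h, fun _ i => ?_⟩
    exact if_neg (not_lt.2 (pick_eq_none hp i))
  · rw [hq, hp]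
    refine ⟨fun i q h => ?_, fun h => by simp at h⟩
    simp only [Option.elim_some, Sum.inl.injEq, Prod.mk.injEq] at h
    obtain ⟨rfl, rfl⟩ := h
    exact if_pos (pick_eq_some hp)

lemma strategy_separable : (s.strategy d).Separable := by
  refine ⟨fun _ _ => 0, fun _ h _ => s.coord h, fun _ => measurable_const, ?_,
    fun _ _ => measurable_const, fun x y k => s.strategy_splitsAs y x k⟩
  rw [iIndepFun_iff_measure_inter_preimage_eq_mul]
  intro S sets _
  by_cases h : ∀ i ∈ S, (0 : I) ∈ sets i
  · have : ∀ i ∈ S, (fun _ : I => (0 : I)) ⁻¹' sets i = Set.univ := fun i hi =>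
      Set.eq_univ_of_forall fun _ => h i hi
    rw [Set.iInter₂_congr this, Finset.prod_congr rfl fun i hi => by rw [this i hi]]
    simp
  · push Not at h
    obtain ⟨i, hi, hi0⟩ := h
    have : (fun _ : I => (0 : I)) ⁻¹' sets i = ∅ := Set.eq_empty_of_forall_notMem fun _ => hi0
    rw [Finset.prod_eq_zero hi (by rw [this, measure_empty])]
    exact measure_mono_null (Set.iInter₂_subset i hi) (by rw [this, measure_empty])

lemma strategy_submitsAtMost : (s.strategy d).SubmitsAtMost (d * N) := by
  intro x y
  set φ := s.strategy d
  set ℓ : ℕ → Fin d → ℕ := fun k i => (coordHist i (φ.hist x y k)).length with hℓ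
  have hle : ∀ k i, ℓ k i ≤ N := fun k i => by
    simp only [hℓ]
    rw [(s.strategy_splitsAs y).coordHist_eq_run x i k]
    exact s.length_run_coord_le _ _
  have hsum : ∀ k, φ.queries x y k = Sum.inr () ∨ k ≤ ∑ i, ℓ k i := by
    intro k
    induction k with
    | zero => right; exact Nat.zero_le _
    | succ k ih =>
      rcases hc : moveCoord (φ.queries x y k) with _ | j
      · left
        rw [moveCoord_eq_none] at hc
        rw [Strategy.queries, Strategy.hist_eq_of_stopped hc (Nat.le_succ k)]
        exact hc
      · right
        have hk : k ≤ ∑ i, ℓ k i := ih.resolve_left fun h => by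
          rw [moveCoord_eq_none.2 h] at hc; cases hc
        have hstep : ∀ i, ℓ (k + 1) i = ℓ k i + if i = j then 1 else 0 := fun i => by
          simp only [hℓ]
          split_ifs with hij
          · subst hij
            rw [Strategy.coordHist_hist_succ_self hc, List.length_cons]
          · rw [Strategy.coordHist_hist_succ_of_ne, add_zero]
            rw [hc]
            exact fun h => hij (Option.some.inj h).symm
        rw [Finset.sum_congr rfl fun i _ => hstep i, Finset.sum_add_distrib]
        simpa using hk
  by_contra hcon
  have h1 := (hsum (d * N)).resolve_left hcon
  rcases hc : moveCoord (φ.queries x y (d * N)) with _ | j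
  · exact hcon (moveCoord_eq_none.1 hc)
  · have h2 := (s.strategy_splitsAs y).apply_coordHist hc
    have h3 : ℓ (d * N) j < N := by
      rw [coord] at h2
      split_ifs at h2 with h'
      exact h'
    have h4 : ∑ i, ℓ (d * N) i < ∑ _i : Fin d, N :=
      Finset.sum_lt_sum (fun i _ => hle _ i) ⟨j, Finset.mem_univ j, h3⟩
    rw [Finset.sum_const, Finset.card_univ, Fintype.card_fin, smul_eq_mul] at h4
    omega

lemma strategy_accurate (hW : 0 < W) {ε : ℝ} (hε : 1 / (W : ℝ) ≤ ε) :
    (s.strategy d).Accurate ε := by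
  refine ae_of_all _ fun p => ⟨d * N, s.strategy_submitsAtMost p.1 p.2, ?_⟩
  have hW' : (0 : ℝ) < W := by exact_mod_cast hW
  have hε0 : 0 ≤ ε := le_trans (by positivity) hε
  refine (pi_norm_le_iff_of_nonneg (by linarith)).2 fun i => ?_
  have hfinal : coordHist i ((s.strategy d).hist p.1 p.2 (d * N)) =
      s.ans (gridIndex W (p.1 i)) N := by
    have hd : 1 ≤ d := i.pos
    rw [(s.strategy_splitsAs p.2).coordHist_final s.strategy_submitsAtMost p.1 i,
      ← s.run_coord hW (p.1 i) le_rfl]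
    refine run_eq_of_stopped ?_ (Nat.le_mul_of_pos_left N hd)
    rw [s.run_coord hW (p.1 i) le_rfl, coord, length_ans, if_neg (lt_irrefl N)]
  have hest : (s.strategy d).est ((s.strategy d).hist p.1 p.2 (d * N)) p.2 i =
      ((gridIndex W (p.1 i) : ℝ) + 1 / 2) / W := by
    rw [← s.decode_ans (gridIndex_lt hW (p.1 i)), ← hfinal]; rfl
  rw [Pi.sub_apply, hest, Real.norm_eq_abs, abs_le]
  have h1 := gridIndex_div_le hW (p.1 i)
  have h2 := le_gridIndex_add_one_div hW (p.1 i)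
  have h3 : ((gridIndex W (p.1 i) : ℝ) + 1 / 2) / W =
      (gridIndex W (p.1 i) : ℝ) / W + 1 / 2 * (1 / W) := by ring
  have h4 : ((gridIndex W (p.1 i) : ℝ) + 1) / W = (gridIndex W (p.1 i) : ℝ) / W + 1 / W := by ring
  rw [h4] at h2
  rw [h3]
  constructor <;> linarith

lemma strategy_queries (hW : 0 < W) (x : Fin d → I) (y : I) (k : ℕ) :
    (s.strategy d).queries x y k =
      (pick N fun i => (coordHist i ((s.strategy d).hist x y k)).length).elim (Sum.inr ()) fun i =>
        Sum.inl (i, gridPoint W (s.thr (gridIndex W (x i))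
          (coordHist i ((s.strategy d).hist x y k)).length)) := by
  set H := (s.strategy d).hist x y k with hH
  have hq : (s.strategy d).queries x y k = (pick N fun i => (coordHist i H).length).elim
    (Sum.inr ()) fun i =>
      Sum.inl (i, gridPoint W (s.thr (s.decode (coordHist i H)) (coordHist i H).length)) := rfl
  rw [hq]
  rcases hp : pick N fun i => (coordHist i H).length with _ | j
  · rfl
  · have hlt := pick_eq_some hp
    have hrun := (s.strategy_splitsAs y).coordHist_eq_run x j k
    rw [← hH, s.run_coord hW (x j) hlt.le] at hrun
    have := s.thr_decode_ans (gridIndex_lt hW (x j)) hlt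
    rw [← hrun] at this
    simp only [Option.elim_some, this]

/-- If the thresholds for the coordinates of `x` and `x'` are the same, so is the whole query
sequence. -/
lemma strategy_queries_congr (hW : 0 < W) {x x' : Fin d → I}
    (h : ∀ i n, s.thr (gridIndex W (x i)) n = s.thr (gridIndex W (x' i)) n) (y y' : I) :
    (s.strategy d).queries x y = (s.strategy d).queries x' y' := by
  funext k
  induction k using Nat.strong_induction_on with
  | _ k ih =>
    have hlen : ∀ i, (coordHist i ((s.strategy d).hist x y k)).length =
        (coordHist i ((s.strategy d).hist x' y' k)).length := fun i => by
      rw [Strategy.length_coordHist_hist, Strategy.length_coordHist_hist]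
      congr 1
      refine Finset.filter_congr fun k' hk' => ?_
      rw [ih k' (Finset.mem_range.1 hk')]
    rw [s.strategy_queries hW, s.strategy_queries hW]
    simp only [hlen, h]

end Scheme

/-! ### Privacy of the replicated bisection -/

/-- An interval of length `δ` contains at most the share of one interval in a family of intervals
that are translates of each other by multiples of some `τ ≥ δ`. -/
lemma volume_iUnion_translates_inter_le (G : ℕ) {β w τ z δ : ℝ} (hτ : δ ≤ τ) :
    volume ((⋃ j : Fin G, Set.Icc (β + j * τ) (β + j * τ + w)) ∩
      Set.Icc (z - δ / 2) (z + δ / 2)) ≤ ENNReal.ofReal w := by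
  set D : Fin G → Set ℝ := fun j => Set.Icc β (β + w) ∩
    Set.Ioc (z - δ / 2 - j * τ) (z + δ / 2 - j * τ) with hD
  have hpiece : ∀ j : Fin G, volume (Set.Icc (β + j * τ) (β + j * τ + w) ∩
      Set.Icc (z - δ / 2) (z + δ / 2)) = volume (D j) := by
    intro j
    have hae : (Set.Icc (β + j * τ) (β + j * τ + w) ∩ Set.Icc (z - δ / 2) (z + δ / 2) : Set ℝ)
        =ᵐ[volume] (Set.Icc (β + j * τ) (β + j * τ + w) ∩ Set.Ioc (z - δ / 2) (z + δ / 2) :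
          Set ℝ) := ae_eq_set_inter (ae_eq_refl _) Ioc_ae_eq_Icc.symm
    rw [measure_congr hae, ← measure_preimage_add_right volume (j * τ)]
    congr 1
    ext t
    simp only [hD, Set.mem_preimage, Set.mem_inter_iff, Set.mem_Icc, Set.mem_Ioc]
    constructor
    · rintro ⟨⟨h1, h2⟩, h3, h4⟩
      exact ⟨⟨by linarith, by linarith⟩, by linarith, by linarith⟩
    · rintro ⟨⟨h1, h2⟩, h3, h4⟩
      exact ⟨⟨by linarith, by linarith⟩, by linarith, by linarith⟩
  have hdisj : Pairwise (Function.onFun Disjoint D) := by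
    -- A translation by at least `τ` moves a half-open interval of length `δ ≤ τ` off itself.
    have key : ∀ (i j : Fin G), i < j → ∀ t, t ∈ D i → t ∉ D j := by
      rintro i j hij t ⟨-, h1, -⟩ ⟨-, h3, h4⟩
      have h5 : (i : ℝ) + 1 ≤ j := by exact_mod_cast hij
      rcases le_or_gt τ 0 with hτ0 | hτ0
      · linarith
      · nlinarith
    intro i j hij
    refine Set.disjoint_left.2 fun t hi hj => ?_
    rcases lt_or_gt_of_ne hij with h | h
    · exact key i j h t hi hj
    · exact key j i h t hj hi
  calc _ = volume (⋃ j : Fin G, Set.Icc (β + j * τ) (β + j * τ + w) ∩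
        Set.Icc (z - δ / 2) (z + δ / 2)) := by rw [Set.iUnion_inter]
    _ ≤ ∑' j : Fin G, volume (Set.Icc (β + j * τ) (β + j * τ + w) ∩
        Set.Icc (z - δ / 2) (z + δ / 2)) := measure_iUnion_le _
    _ = volume (⋃ j, D j) := by
        rw [measure_iUnion hdisj fun j => measurableSet_Icc.inter measurableSet_Ioc]
        exact tsum_congr hpiece
    _ ≤ volume (Set.Icc β (β + w)) :=
        measure_mono (Set.iUnion_subset fun j => Set.inter_subset_left)
    _ = ENNReal.ofReal w := by rw [Real.volume_Icc]; congr 1; ring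

/-- Given the block and the position in the sub-block of a uniform point, the set of its possible
values has a share of at most one of the `G` cells in common with an interval of length `δ`. -/
lemma volume_code_inter_le {K G M : ℕ} (hG : 0 < G) {δ : ℝ} (hδ : δ ≤ 1 / (2 ^ K * G : ℝ))
    (a r : ℕ) (z : ℝ) :
    volume {t : I | (gridIndex (2 ^ K * (G * 2 ^ M)) t / (G * 2 ^ M) = a ∧
      gridIndex (2 ^ K * (G * 2 ^ M)) t % 2 ^ M = r) ∧ |z - t| ≤ δ / 2} ≤
      ENNReal.ofReal (1 / (2 ^ K * (G * 2 ^ M) : ℕ)) := by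
  set W := 2 ^ K * (G * 2 ^ M) with hWdef
  have hW : 0 < W := by positivity
  have hW' : (0 : ℝ) < W := by exact_mod_cast hW
  refine le_trans (le_trans (measure_mono ?_) (volume_coe_mem_le _))
    (volume_iUnion_translates_inter_le G (β := (a * (G * 2 ^ M) + r : ℕ) / W) (z := z) hδ)
  rintro t ⟨⟨ha, hr⟩, ht⟩
  rw [abs_le] at ht
  refine ⟨Set.mem_iUnion.2 ⟨⟨gridIndex W t / 2 ^ M % G, Nat.mod_lt _ hG⟩, ?_⟩, ?_, ?_⟩
  · have h1 := gridIndex_div_le hW t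
    have h2 := le_gridIndex_add_one_div hW t
    have h3 : gridIndex W t = a * (G * 2 ^ M) + r + gridIndex W t / 2 ^ M % G * 2 ^ M := by
      have e1 := Nat.div_add_mod (gridIndex W t) (2 ^ M)
      have e2 := Nat.div_add_mod (gridIndex W t / 2 ^ M) G
      have e3 : gridIndex W t / (G * 2 ^ M) = gridIndex W t / 2 ^ M / G := by
        rw [mul_comm, Nat.div_div_eq_div_mul]
      rw [e3] at ha
      calc gridIndex W t = 2 ^ M * (gridIndex W t / 2 ^ M) + r := by rw [← hr]; exact e1.symm
        _ = 2 ^ M * (G * a + gridIndex W t / 2 ^ M % G) + r := by rw [← ha, e2]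
        _ = _ := by ring
    have h4 : (gridIndex W t : ℝ) / W = ((a * (G * 2 ^ M) + r : ℕ) : ℝ) / W +
        (gridIndex W t / 2 ^ M % G : ℕ) * (1 / (2 ^ K * G : ℝ)) := by
      conv_lhs => rw [h3]
      have hG' : (0 : ℝ) < G := by exact_mod_cast hG
      rw [hWdef]
      push_cast
      field_simp
    rw [add_div, h4] at h2
    rw [h4] at h1
    exact ⟨h1, h2⟩
  · linarith
  · linarith

/-- The queries depend only on the block and the position in the sub-block of each coordinate. This
leaves `G` cells for each coordinate, at distances of at least `δ`. -/
theorem repScheme_strategy_isPrivate {d L K G M : ℕ} (hG : 0 < G) {δ : ℝ}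
    (hδ : δ ≤ 1 / (2 ^ K * G : ℝ)) (hL : L ≤ G ^ d) :
    ((repScheme K M hG).strategy d).IsPrivate δ L := by
  set W := 2 ^ K * (G * 2 ^ M) with hWdef
  have hW : 0 < W := by positivity
  set φ := (repScheme K M hG).strategy d with hφ
  rintro ⟨A, hA, hlt⟩
  refine absurd hlt (not_lt.2 ?_)
  set code : (Fin d → I) → Fin d → ℕ × ℕ := fun x i =>
    (gridIndex W (x i) / (G * 2 ^ M), gridIndex W (x i) % 2 ^ M) with hcode
  set codes : Finset (Fin d → ℕ × ℕ) :=
    Fintype.piFinset fun _ : Fin d => Finset.range (2 ^ K) ×ˢ Finset.range (2 ^ M) with hcodes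
  have hmem : ∀ x, code x ∈ codes := fun x => Fintype.mem_piFinset.2 fun i =>
    Finset.mem_product.2 ⟨Finset.mem_range.2 (Nat.div_lt_of_lt_mul
      (lt_of_lt_of_eq (gridIndex_lt hW (x i)) (mul_comm _ _))),
      Finset.mem_range.2 (Nat.mod_lt _ (by positivity))⟩
  obtain ⟨Q, hQ⟩ : ∃ Q : (Fin d → ℕ × ℕ) → ℕ → Move d, ∀ x y, φ.queries x y = Q (code x) := by
    classical
    refine ⟨fun c => if h : ∃ x, code x = c then φ.queries h.choose 0 else fun _ => Sum.inr (),
      fun x y => ?_⟩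
    have h : ∃ x', code x' = code x := ⟨x, rfl⟩
    beta_reduce
    rw [dif_pos h]
    refine Scheme.strategy_queries_congr _ hW (fun i n => ?_) _ _
    have hi := congrFun h.choose_spec i
    exact repThr_congr_of_code (Prod.ext_iff.1 hi).1.symm (Prod.ext_iff.1 hi).2.symm n
  set D : (Fin d → ℕ × ℕ) → I → Fin d → Set I := fun c u i => {t | (gridIndex W t / (G * 2 ^ M) =
    (c i).1 ∧ gridIndex W t % 2 ^ M = (c i).2) ∧ |A (Q c, u) i - t| ≤ δ / 2} with hD
  have hidx : Measurable (gridIndex W) := (gridIndex_mono W).measurable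
  set T : (Fin d → ℕ × ℕ) → Set (((Fin d → I) × I) × I) := fun c =>
    {p | ∀ i, p.1.1 i ∈ D c p.2 i} with hT
  have hTmeas : ∀ c, MeasurableSet (T c) := fun c => by
    have : T c = ⋂ i, (({p | gridIndex W (p.1.1 i) / (G * 2 ^ M) = (c i).1} ∩
        {p | gridIndex W (p.1.1 i) % 2 ^ M = (c i).2}) ∩
        {p : ((Fin d → I) × I) × I | |A (Q c, p.2) i - p.1.1 i| ≤ δ / 2}) := by
      ext p
      simp [hT, hD]
    rw [this]
    have hx : ∀ i, Measurable fun p : ((Fin d → I) × I) × I => p.1.1 i := fun i =>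
      (measurable_pi_apply i).comp (measurable_fst.comp measurable_fst)
    have hAi : ∀ i, Measurable fun p : ((Fin d → I) × I) × I => A (Q c, p.2) i := fun i =>
      (measurable_pi_apply i).comp (hA.comp (measurable_const.prodMk measurable_snd))
    exact MeasurableSet.iInter fun i => (((hidx.comp (hx i))
      (MeasurableSet.of_discrete (s := {k | k / (G * 2 ^ M) = (c i).1}))).inter
      ((hidx.comp (hx i)) (MeasurableSet.of_discrete (s := {k | k % 2 ^ M = (c i).2})))).inter
      (measurableSet_le (((hAi i).sub (measurable_subtype_coe.comp (hx i))).abs) measurable_const)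
  have hTle : ∀ c, volume (T c) ≤ ENNReal.ofReal (1 / (W : ℝ)) ^ d := fun c => by
    rw [Measure.volume_eq_prod, Measure.prod_apply_symm (hTmeas c)]
    calc _ ≤ ∫⁻ _ : I, ENNReal.ofReal (1 / (W : ℝ)) ^ d := by
          refine lintegral_mono fun u => ?_
          have : (fun q : (Fin d → I) × I => (q, u)) ⁻¹' T c =
              (Set.univ.pi (D c u)) ×ˢ Set.univ := by
            ext q
            simp [hT]
          rw [this]
          calc _ = volume (Set.univ.pi (D c u)) * volume (Set.univ : Set I) :=
                Measure.prod_prod _ _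
            _ = ∏ i, volume (D c u i) := by rw [measure_univ, mul_one, volume_pi_pi]
            _ ≤ ∏ _i : Fin d, ENNReal.ofReal (1 / (W : ℝ)) :=
                Finset.prod_le_prod' fun i _ => volume_code_inter_le hG hδ _ _ _
            _ = _ := by simp
      _ = _ := by simp
  calc _ ≤ volume (⋃ c ∈ codes, T c) := by
        refine measure_mono fun p hp => Set.mem_iUnion₂.2 ⟨code p.1.1, hmem _, fun i => ?_⟩
        refine ⟨⟨rfl, rfl⟩, ?_⟩
        have h := (norm_le_pi_norm _ i).trans hp
        rw [hQ, Pi.sub_apply, Real.norm_eq_abs] at h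
        exact h
    _ ≤ ∑ c ∈ codes, volume (T c) := measure_biUnion_finset_le _ _
    _ ≤ ∑ c ∈ codes, ENNReal.ofReal (1 / (W : ℝ)) ^ d := Finset.sum_le_sum fun c _ => hTle c
    _ = ENNReal.ofReal (1 / (G : ℝ)) ^ d := by
        have hcard : codes.card = (2 ^ K * 2 ^ M) ^ d := by simp [hcodes]
        rw [Finset.sum_const, hcard, nsmul_eq_mul, Nat.cast_pow, ← mul_pow,
          ← ENNReal.ofReal_natCast, ← ENNReal.ofReal_mul (Nat.cast_nonneg _)]
        congr 2
        have hG' : (0 : ℝ) < G := by exact_mod_cast hG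
        rw [hWdef]
        push_cast
        field_simp
    _ ≤ _ := by
        have hG' : (0 : ℝ) < G := by exact_mod_cast hG
        rw [one_div, ENNReal.ofReal_inv_of_pos hG', ENNReal.ofReal_natCast, ← ENNReal.inv_pow,
          ENNReal.inv_le_inv]
        exact_mod_cast hL

/-! ### The upper bound -/

/-- The replicated bisection with `G = ⌈γ⌉`, `K = ⌊log₂ (1 / (G δ))⌋` and `M = ⌈log₂ (δ / ε)⌉ + 1`
attains the bound on each coordinate. -/
theorem exists_separable_strategy {d L : ℕ} (hd : 1 ≤ d) (hL : 2 ≤ L) {ε δ : ℝ} (hε : 0 < ε)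
    (hεδ : 2 * ε ≤ δ) (hδ : δ ≤ 1 / (⌈gam L d⌉ : ℝ)) :
    ∃ (φ : Strategy d) (n : ℕ), φ.Separable ∧ φ.Accurate ε ∧ φ.IsPrivate δ L ∧
      φ.SubmitsAtMost n ∧ (n : ℤ) = d * (⌊Real.logb 2 (1 / (⌈gam L d⌉ * δ))⌋
        + ⌈gam L d⌉ * (⌈Real.logb 2 (δ / ε)⌉ + 2) - 1) := by
  have hδ0 : 0 < δ := by linarith
  have hγ := one_lt_gam hd hL
  have hGδ := ceil_gam_mul_le_one hd hL hδ
  have hG1 : 0 < ⌈gam L d⌉ := Int.ceil_pos.2 (by linarith)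
  obtain ⟨G, hGeq⟩ := Int.eq_ofNat_of_zero_le hG1.le
  have hGL : L ≤ G ^ d := by
    have h1 : gam L d ≤ G := by
      have := Int.le_ceil (gam L d)
      rw [hGeq] at this
      exact_mod_cast this
    have h2 := pow_le_pow_left₀ (by linarith) h1 d
    rw [gam_pow hd] at h2
    exact_mod_cast h2
  rw [hGeq] at hGδ hG1 ⊢
  rw [Int.cast_natCast] at hGδ ⊢
  have hG : 0 < G := by exact_mod_cast hG1
  have hG' : (0 : ℝ) < G := by exact_mod_cast hG
  have hGδ0 : 0 < G * δ := by positivity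
  obtain ⟨K, hK⟩ := Int.eq_ofNat_of_zero_le (Int.floor_nonneg.2
    (Real.logb_nonneg one_lt_two ((one_le_div hGδ0).2 hGδ)))
  have hK1 : (2 : ℝ) ^ K ≤ 1 / (G * δ) := by
    have h1 := Int.floor_le (Real.logb 2 (1 / (G * δ)))
    rw [hK, Int.cast_natCast, Real.le_logb_iff_rpow_le one_lt_two (by positivity),
      Real.rpow_natCast] at h1
    exact h1
  have hK2 : 1 / (G * δ) < (2 : ℝ) ^ (K + 1) := by
    have h1 := Int.lt_floor_add_one (Real.logb 2 (1 / (G * δ)))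
    rw [hK, Int.cast_natCast, Real.logb_lt_iff_lt_rpow one_lt_two (by positivity)] at h1
    exact_mod_cast h1
  obtain ⟨m, hm⟩ := Int.eq_ofNat_of_zero_le (Int.ceil_nonneg (Real.logb_nonneg one_lt_two
    ((one_le_div hε).2 (by linarith : ε ≤ δ))))
  have hm1 : δ / ε ≤ (2 : ℝ) ^ m := by
    have h1 := Int.le_ceil (Real.logb 2 (δ / ε))
    rw [hm, Int.cast_natCast, Real.logb_le_iff_le_rpow one_lt_two (by positivity),
      Real.rpow_natCast] at h1
    exact h1
  set M := m + 1 with hM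
  have hW : 0 < 2 ^ K * (G * 2 ^ M) := by positivity
  refine ⟨(repScheme K M hG).strategy d, d * (K + (G - 1) + G * M), Scheme.strategy_separable _,
    Scheme.strategy_accurate _ hW ?_, repScheme_strategy_isPrivate hG ?_ hGL,
    Scheme.strategy_submitsAtMost _, ?_⟩
  · -- `2 ^ (K + 1) ≥ 1 / (G * δ)` and `2 ^ m ≥ δ / ε` make the cells of length at most `ε`.
    rw [div_le_iff₀ (by exact_mod_cast hW)]
    push_cast
    rw [div_le_iff₀ hε] at hm1
    rw [div_lt_iff₀ hGδ0] at hK2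
    calc (1 : ℝ) ≤ 2 ^ (K + 1) * (G * δ) := hK2.le
      _ ≤ 2 ^ (K + 1) * (G * (2 ^ m * ε)) := by gcongr
      _ = ε * (2 ^ K * (G * 2 ^ M)) := by rw [hM, pow_succ, pow_succ]; ring
  · rw [le_div_iff₀ (by positivity)]
    rw [le_div_iff₀ hGδ0] at hK1
    linarith
  · rw [hK, hm, hM]
    push_cast [Nat.cast_sub hG]
    ring

end PrivateLearning

theorem theorem3 (d L : ℕ) (hd : 1 ≤ d) (hL : 2 ≤ L) (ε δ : ℝ) (hε : 0 < ε)
    (hεδ : 2 * ε ≤ δ) (hδ : δ ≤ 1 / (⌈PrivateLearning.gam L d⌉ : ℝ)) :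
    ((PrivateLearning.budgets (Set.univ : Set (PrivateLearning.Strategy d)) ε δ L).Nonempty ∧
      (PrivateLearning.queryComplexity (Set.univ : Set (PrivateLearning.Strategy d)) ε δ L : ℤ) ≤
        d * (⌊Real.logb 2 (1 / (⌈PrivateLearning.gam L d⌉ * δ))⌋
          + ⌈PrivateLearning.gam L d⌉ * (⌈Real.logb 2 (δ / ε)⌉ + 2) - 1)) ∧
    ((PrivateLearning.budgets
        {φ : PrivateLearning.Strategy d | φ.Separable} ε δ L).Nonempty ∧
      (d : ℝ) * ((⌊Real.logb 2 (1 / (PrivateLearning.gam L d * δ))⌋ : ℝ)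
          + PrivateLearning.gam L d * (Real.logb 2 (δ / ε) - 2) - 1) ≤
        (PrivateLearning.queryComplexity
          {φ : PrivateLearning.Strategy d | φ.Separable} ε δ L : ℝ)) := by
  obtain ⟨φ, n, hsep, hacc, hpriv, hn, hcard⟩ :=
    PrivateLearning.exists_separable_strategy hd hL hε hεδ hδ
  have hmem : n ∈ PrivateLearning.budgets (Set.univ : Set (PrivateLearning.Strategy d)) ε δ L :=
    ⟨φ, Set.mem_univ _, hacc, hpriv, hn⟩
  have hne : (PrivateLearning.budgets
      {φ : PrivateLearning.Strategy d | φ.Separable} ε δ L).Nonempty := ⟨n, φ, hsep, hacc, hpriv, hn⟩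
  refine ⟨⟨⟨n, hmem⟩, ?_⟩, hne, ?_⟩
  · rw [← hcard]
    exact_mod_cast Nat.sInf_le hmem
  · obtain ⟨φ', hsep', hacc', hpriv', hn'⟩ := Nat.sInf_mem hne
    exact hsep'.le_of_submitsAtMost hd hL hε hεδ hδ hacc' hpriv' hn'
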